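/- **Setting (HRT-MSLQ).** An instance $I$ consists of a set $R$ of $n$ residents, a finite set $H$ of hospitals, a set $E\subseteq R\times H$ of (mutually) acceptable pairs, for each resident a preference list (possibly with ties, i.e. a weak order) over her acceptable hospitals, for each hospital a preference list (possibly with ties) over its acceptable residents, and for each $h\in H$ a lower quota $\ell(h)$ and an upper quota $u(h)$, which are integers with $0\le \ell(h)\le u(h)\le n$. A matching is a set $M\subseteq E$ such that every resident $r$ lies in at most one pair of $M$ and $|M(h)|\le u(h)$ for every $h\in H$, where $M(h)=\{r : (r,h)\in M\}$. A pair $(r,h)\in E$ blocks $M$ if $r$ is unmatched or strictly prefers $h$ to her assigned hospital, and $|M(h)|<u(h)$ or $h$ strictly prefers $r$ to some resident in $M(h)$. A matching is stable if no pair blocks it. Its score is $s(M)=\sum_{h\in H}s_M(h)$, where $s_M(h)=\min\{1,|M(h)|/\ell(h)\}$ if $\ell(h)>0$ and $s_M(h)=1$ if $\ell(h)=0$. Let $\mathrm{OPT}(I)$ be the maximum score of a stable matching of $I$. **Algorithm Triple Proposal.** Start with $M=\emptyset$, with $\mathrm{state}(r)=0$ for every resident $r$, and with the current list of every resident equal to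 her preference list. While there is an unmatched resident with nonempty current list and state at most $1$, choose such a resident $r$ and let $T$ be the top tie of her current list. If $T$ contains a hospital to which $r$ has not yet proposed, let $h$ be such a hospital with minimum $\ell(h)$; otherwise let $h$ be a hospital in $T$ with minimum $\ell(h)$. Then $r$ proposes to $h$, with the first applicable outcome below. 1. If $|M(h)|<\ell(h)$, add $(r,h)$ to $M$. 2. If some resident in $M(h)\cup\{r\}$ has not been rejected by $h$ so far, choose such a resident $r'$ (possibly $r'=r$) and replace $M$ by $(M\cup\{(r,h)\})\setminus\{(r',h)\}$; thus $h$ rejects $r'$. 3. If $|M(h)|<u(h)$, add $(r,h)$ to $M$. 4. Otherwise let $r'$ be a worst resident for $h$ in $M(h)\cup\{r\}$ (possibly $r'=r$), having minimum state among the worst ones; replace $M$ by $(M\cup\{(r,h)\})\setminus\{(r',h)\}$ (so $h$ rejects $r'$), and delete $h$ from the current list of $r'$. If that list becomes empty, increase $\mathrm{state}(r')$ by $1$ and restore the original list of $r'$. When the loop ends, output $M$. All remaining choices are arbitrary, so an instance may have several possible outputs. For a family $\mathcal I$ of instances with $n$ residents, the approximation factor of Triple Proposal is $$\mathrm{APPROX}(\mathcal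 I)=\max\frac{\mathrm{OPT}(I)}{s(M)},$$ the maximum being over all $I\in\mathcal I$ and all possible outputs $M$ of Triple Proposal on $I$ with $s(M)>0$. Let $\mathcal I_{\mathrm{Gen}}$ be the family of all instances with $n$ residents (and any finite number of hospitals), and let $\mathcal I_{R\text{-}\mathrm{ML}}$ be the subfamily of those for which there is one master preference list over $H$ (possibly with ties) from which every resident's list is obtained by deleting the hospitals unacceptable to her. **Theorem.** On every instance with $n\ge1$ residents, every execution of Triple Proposal terminates, at least one output exists, and every output is a stable matching; moreover, if an output $M$ has $s(M)=0$, then $\mathrm{OPT}(I)=0$. For every $n\ge 1$ both maxima below exist, and $$\mathrm{APPROX}(\mathcal I_{\mathrm{Gen}})=\mathrm{APPROX}(\mathcal I_{R\text{-}\mathrm{ML}})=\phi(n),$$ where $$\phi(1)=1,\qquad \phi(2)=\tfrac32,\qquad \phi(n)=\frac{n\,(1+\lfloor n/2\rfloor)}{n+\lfloor n/2\rfloor}\quad\text{for } n\ge 3.$$ -/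

import Mathlib

namespace HRTMSLQ

/-- An instance of HRT-MSLQ with residents `Fin n` and hospitals `Fin m`: the set `E` of (mutually)
acceptable pairs, the preference lists, and the quotas. A preference list with ties is given by the
position of the tie in which an agent stands (a smaller rank is better, equal ranks are a tie); only
the ranks of acceptable agents are ever used. -/
structure Instance (n m : ℕ) where
  E : Finset (Fin n × Fin m)
  resRank : Fin n → Fin m → ℕ
  hospRank : Fin m → Fin n → ℕ
  lower : Fin m → ℕ
  upper : Fin m → ℕ
  lower_le_upper : ∀ h, lower h ≤ upper h
  upper_le : ∀ h, upper h ≤ n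

variable {n m : ℕ}

/-- `M(h)`: the residents assigned to the hospital `h`. -/
def assigned (M : Finset (Fin n × Fin m)) (h : Fin m) : Finset (Fin n) :=
  Finset.univ.filter fun r => (r, h) ∈ M

/-- `M(r)`: the hospitals to which the resident `r` is assigned. -/
def hospitalsOf (M : Finset (Fin n × Fin m)) (r : Fin n) : Finset (Fin m) :=
  Finset.univ.filter fun h => (r, h) ∈ M

def IsMatching (I : Instance n m) (M : Finset (Fin n × Fin m)) : Prop :=
  M ⊆ I.E ∧ (∀ r, (hospitalsOf M r).card ≤ 1) ∧ ∀ h, (assigned M h).card ≤ I.upper h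

/-- The acceptable pair `(r, h)` blocks `M`. The second conjunct says that `r` is unmatched or
prefers `h` to the hospital to which she is assigned. -/
def Blocks (I : Instance n m) (M : Finset (Fin n × Fin m)) (r : Fin n) (h : Fin m) : Prop :=
  (r, h) ∈ I.E ∧
  (∀ h' ∈ hospitalsOf M r, I.resRank r h < I.resRank r h') ∧
  ((assigned M h).card < I.upper h ∨ ∃ r' ∈ assigned M h, I.hospRank h r < I.hospRank h r')

def IsStable (I : Instance n m) (M : Finset (Fin n × Fin m)) : Prop :=
  IsMatching I M ∧ ∀ r h, ¬ Blocks I M r h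

/-- The satisfaction ratio of a single hospital. -/
noncomputable def hospScore (I : Instance n m) (M : Finset (Fin n × Fin m)) (h : Fin m) : ℝ :=
  if I.lower h = 0 then 1 else min 1 (((assigned M h).card : ℝ) / (I.lower h : ℝ))

/-- The total satisfaction ratio `s(M)`. -/
noncomputable def score (I : Instance n m) (M : Finset (Fin n × Fin m)) : ℝ :=
  ∑ h, hospScore I M h

/-- `N` is a stable matching of maximum score, so that `score I N` is `OPT(I)`. -/
def IsOptimal (I : Instance n m) (N : Finset (Fin n × Fin m)) : Prop :=
  IsStable I N ∧ ∀ N', IsStable I N' → score I N' ≤ score I N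

/-- The preference list of `r` in the input, as a set (the order is given by `I.resRank r`). -/
def fullList (I : Instance n m) (r : Fin n) : Finset (Fin m) :=
  Finset.univ.filter fun h => (r, h) ∈ I.E

/-- A configuration of the algorithm Triple Proposal: the current assignment, the proposals made so
far, the pairs `(r, h)` such that `r` has been rejected by `h` at least once, the current list of
each resident, and the value `state(r)` of each resident. -/
structure Config (n m : ℕ) where
  M : Finset (Fin n × Fin m)
  proposed : Finset (Fin n × Fin m)
  rejected : Finset (Fin n × Fin m)
  list : Fin n → Finset (Fin m)
  state : Fin n → ℕ

def initConfig (I : Instance n m) : Config n m where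
  M := ∅
  proposed := ∅
  rejected := ∅
  list := fullList I
  state := fun _ => 0

/-- `r` is unmatched, has a nonempty list, and `state(r) ≤ 1`. -/
def Active (c : Config n m) (r : Fin n) : Prop :=
  hospitalsOf c.M r = ∅ ∧ (c.list r).Nonempty ∧ c.state r ≤ 1

/-- The top tie of the current list of `r`. -/
def topTie (I : Instance n m) (c : Config n m) (r : Fin n) : Finset (Fin m) :=
  (c.list r).filter fun h => ∀ h' ∈ c.list r, I.resRank r h ≤ I.resRank r h'

/-- `r` may be the next resident to propose, and `h` may be the hospital she proposes to: if the top
tie contains hospitals to which she has not proposed yet, `h` is one of those with minimum lower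
quota, and otherwise `h` is a hospital of the top tie with minimum lower quota. -/
def MayPropose (I : Instance n m) (c : Config n m) (r : Fin n) (h : Fin m) : Prop :=
  Active c r ∧ h ∈ topTie I c r ∧
  (((r, h) ∉ c.proposed ∧
      ∀ h' ∈ topTie I c r, (r, h') ∉ c.proposed → I.lower h ≤ I.lower h') ∨
    ((∀ h' ∈ topTie I c r, (r, h') ∈ c.proposed) ∧
      ∀ h' ∈ topTie I c r, I.lower h ≤ I.lower h'))

/-- The residents among whom `h` decides when `r` proposes: `M(h) ∪ {r}`. -/
def candidates (c : Config n m) (r : Fin n) (h : Fin m) : Finset (Fin n) :=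
  insert r (assigned c.M h)

/-- `r'` is a worst resident for `h` among the candidates, and has the minimum value of the state
among the worst ones. -/
def IsVictim (I : Instance n m) (c : Config n m) (r : Fin n) (h : Fin m) (r' : Fin n) : Prop :=
  r' ∈ candidates c r h ∧
  (∀ r'' ∈ candidates c r h, I.hospRank h r'' ≤ I.hospRank h r') ∧
  ∀ r'' ∈ candidates c r h, I.hospRank h r'' = I.hospRank h r' → c.state r' ≤ c.state r''

/-- One iteration of the main loop of Triple Proposal, with all its arbitrary choices: the proposing
resident, the hospital among those with equal priority, and the rejected resident. -/
inductive Step (I : Instance n m) : Config n m → Config n m → Prop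
  /-- `|M(h)| < ℓ(h)`: `h` accepts `r`. -/
  | acceptLower (c : Config n m) (r : Fin n) (h : Fin m)
      (hprop : MayPropose I c r h)
      (hlow : (assigned c.M h).card < I.lower h) :
      Step I c
        { c with
          M := insert (r, h) c.M
          proposed := insert (r, h) c.proposed }
  /-- `|M(h)| ≥ ℓ(h)`, and some candidate `r'` has not been rejected by `h`: `h` rejects `r'`,
  who keeps `h` in her list. -/
  | rejectFirst (c : Config n m) (r : Fin n) (h : Fin m) (r' : Fin n)
      (hprop : MayPropose I c r h)
      (hlow : I.lower h ≤ (assigned c.M h).card)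
      (hr' : r' ∈ candidates c r h)
      (hfresh : (r', h) ∉ c.rejected) :
      Step I c
        { c with
          M := (insert (r, h) c.M).erase (r', h)
          proposed := insert (r, h) c.proposed
          rejected := insert (r', h) c.rejected }
  /-- `ℓ(h) ≤ |M(h)| < u(h)`, and all candidates have been rejected by `h`: `h` accepts `r`. -/
  | acceptUpper (c : Config n m) (r : Fin n) (h : Fin m)
      (hprop : MayPropose I c r h)
      (hlow : I.lower h ≤ (assigned c.M h).card)
      (hold : ∀ r'' ∈ candidates c r h, (r'', h) ∈ c.rejected)
      (hupp : (assigned c.M h).card < I.upper h) :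
      Step I c
        { c with
          M := insert (r, h) c.M
          proposed := insert (r, h) c.proposed }
  /-- `h` is full, and all candidates have been rejected by `h`: `h` rejects a worst candidate `r'`,
  who deletes `h` from her list; if the list is now empty, her state is incremented and her original
  list is recovered. -/
  | rejectWorst (c : Config n m) (r : Fin n) (h : Fin m) (r' : Fin n)
      (hprop : MayPropose I c r h)
      (hlow : I.lower h ≤ (assigned c.M h).card)
      (hold : ∀ r'' ∈ candidates c r h, (r'', h) ∈ c.rejected)
      (hupp : I.upper h ≤ (assigned c.M h).card)
      (hr' : IsVictim I c r h r') :
      Step I c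
        { M := (insert (r, h) c.M).erase (r', h)
          proposed := insert (r, h) c.proposed
          rejected := insert (r', h) c.rejected
          list := Function.update c.list r'
            (if (c.list r').erase h = ∅ then fullList I r' else (c.list r').erase h)
          state := Function.update c.state r'
            (if (c.list r').erase h = ∅ then c.state r' + 1 else c.state r') }

/-- `M` is the output of some execution of Triple Proposal on `I`. -/
def IsOutput (I : Instance n m) (M : Finset (Fin n × Fin m)) : Prop :=
  ∃ c : Config n m, Relation.ReflTransGen (Step I) (initConfig I) c ∧
    (∀ r, ¬ Active c r) ∧ c.M = M

/-- Triple Proposal solves `I` feasibly: no execution is infinite, some execution yields an output,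
and every output is a stable matching. -/
def IsCorrectOn (I : Instance n m) : Prop :=
  (¬ ∃ f : ℕ → Config n m, f 0 = initConfig I ∧ ∀ k, Step I (f k) (f (k + 1))) ∧
  (∃ M, IsOutput I M) ∧
  ∀ M, IsOutput I M → IsStable I M

/-- A model with `n` residents, i.e. a family of instances with `n` residents. -/
abbrev Model (n : ℕ) := ∀ m : ℕ, Instance n m → Prop

/-- The family of all instances with `n` residents. -/
def generalModel (n : ℕ) : Model n := fun _ _ => True

/-- The family of the instances with `n` residents such that the list of every resident is obtained
from one master list (which may contain ties) by deleting the unacceptable hospitals. -/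
def masterListModel (n : ℕ) : Model n := fun m I =>
  ∃ master : Fin m → ℕ, ∀ r h h', (r, h) ∈ I.E → (r, h') ∈ I.E →
    (I.resRank r h < I.resRank r h' ↔ master h < master h')

/-- The ratios `OPT(I) / ALG(I)`, over all instances `I` of the model and all possible outputs of
Triple Proposal on `I` that have a nonzero score. -/
def approxRatios (K : Model n) : Set ℝ :=
  {ρ | ∃ (m : ℕ) (I : Instance n m) (M N : Finset (Fin n × Fin m)),
    K m I ∧ IsOutput I M ∧ IsOptimal I N ∧ 0 < score I M ∧ ρ = score I N / score I M}

/-- The approximation factor of Triple Proposal on the model `K` is `α`: the algorithm always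
terminates with a stable matching, the maximum of `OPT(I) / ALG(I)` is attained and equals `α`, and
`OPT(I) = 0` whenever `ALG(I) = 0` (so that no instance with a zero denominator is worse). -/
def HasApproxFactor (K : Model n) (α : ℝ) : Prop :=
  (∀ (m : ℕ) (I : Instance n m), K m I → IsCorrectOn I) ∧
  IsGreatest (approxRatios K) α ∧
  ∀ (m : ℕ) (I : Instance n m) (M N : Finset (Fin n × Fin m)),
    K m I → IsOutput I M → IsOptimal I N → score I M = 0 → score I N = 0

/-- The function `φ`; `n / 2` is the natural-number quotient `⌊n / 2⌋`. -/
noncomputable def phi (n : ℕ) : ℝ :=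
  if n = 1 then 1
  else if n = 2 then 3 / 2
  else (n : ℝ) * (1 + ((n / 2 : ℕ) : ℝ)) / ((n : ℝ) + ((n / 2 : ℕ) : ℝ))

end HRTMSLQ

/-! Upper bound. Let `μ` be an output and `ν` a stable matching, with scores `s` and `t`, and call a
hospital deficient if `μ` leaves it below its lower quota. The algorithm enters the analysis only
through `IsComparable`. If `ν` sends `r` to a deficient hospital `h`, then `h` never deleted `r`, so
`r` is matched in `μ` to some `h'` at least as good. If `h'` is tied with `h`, the priority for
small lower quotas and the rule of rejecting everybody once bound `ℓ(h')` and `|μ(h')|`; if `h'` is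
strictly better, stability of `ν` makes `h'` full in `ν`.

At every hospital, pair off as many residents of `μ` with residents of `ν` as possible
(`IsPairing`). The pairs cancel in the comparison of scores, and a resident outside both `dom` and
`im` loses in `μ` at least what she gains in `ν`. What remains is `t + loss ≤ s + q`, where `q =
#(dom \ im) ≤ n/2` and `loss` is carried by `im \ dom` (`IsComparable.total_add_loss_le`). If `s ≥
2`, this gives `t/s ≤ 1 + q/2`. If `s < 2`, at most one hospital reaches its quota, and either `t ≤
s` or the weights `1/ℓ ≥ 1/n` of single residents yield `s ≥ 1 + q/n` and `loss ≥ q/n`; then `t/s ≤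
n(1+q)/(n+q)`, which increases with `q`. The two bounds compete only for small `n`, which is why `n
= 2` is exceptional.

Correctness rests on the invariant `Inv`: a hospital that has deleted a resident stays full with
residents it likes at least as much. Termination follows from an integer potential.

Lower bound. In `tight`, residents who could leave room at hospital `0` for others occupy it, and
the others fill a hospital of large lower quota; the same instance has a master list, so it serves
both models. -/

namespace HRTMSLQ

/-! ### Comparing the scores of two assignments -/

section Ratio

open Finset

set_option linter.unusedSectionVars false

variable {R H : Type*} [Fintype R] [DecidableEq R] [Fintype H] [DecidableEq H]

/-- The set of residents that `μ` sends to the hospital `h`. -/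
def fiber (μ : R → Option H) (h : H) : Finset R := univ.filter fun r => μ r = some h

@[simp] lemma mem_fiber {μ : R → Option H} {h : H} {r : R} : r ∈ fiber μ h ↔ μ r = some h := by
  simp [fiber]

/-- The satisfaction ratio of a hospital with lower quota `l` and `a` residents. -/
noncomputable def satRatio (l a : ℕ) : ℝ := if l = 0 then 1 else min 1 ((a : ℝ) / (l : ℝ))

/-- The total satisfaction ratio of an assignment. -/
noncomputable def total (l : H → ℕ) (μ : R → Option H) : ℝ := ∑ h, satRatio (l h) (#(fiber μ h))

lemma satRatio_le_one (l a : ℕ) : satRatio l a ≤ 1 := by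
  unfold satRatio; split_ifs <;> simp

lemma satRatio_nonneg (l a : ℕ) : 0 ≤ satRatio l a := by
  unfold satRatio; split_ifs
  · simp
  · positivity

lemma satRatio_of_le {l a : ℕ} (h : l ≤ a) : satRatio l a = 1 := by
  unfold satRatio; split_ifs with h0
  · rfl
  · have : (0 : ℝ) < l := by positivity
    rw [min_eq_left]
    rw [le_div_iff₀ this]; simpa using h

lemma satRatio_of_lt {l a : ℕ} (h : a < l) : satRatio l a = (a : ℝ) / l := by
  have : (0 : ℝ) < l := by exact_mod_cast (by omega : 0 < l)
  unfold satRatio; rw [if_neg (by omega), min_eq_right]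
  rw [div_le_iff₀ this, one_mul]; exact_mod_cast h.le

lemma satRatio_le_div {l a : ℕ} (h : 0 < l) : satRatio l a ≤ (a : ℝ) / l := by
  unfold satRatio; rw [if_neg (by omega)]; exact min_le_right _ _

lemma sum_elim_eq_sum_fiber {α : Type*} [AddCommMonoid α] (μ : R → Option H) (A : Finset R)
    (f : H → α) :
    ∑ r ∈ A, (μ r).elim 0 f = ∑ h, #(A ∩ fiber μ h) • f h := by
  have h1 : ∀ r, (μ r).elim 0 f = ∑ h, if μ r = some h then f h else 0 := by
    intro r
    cases hr : μ r with
    | none => simp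
    | some h => simp
  simp_rw [h1]
  rw [sum_comm]
  refine sum_congr rfl fun h _ => ?_
  rw [← sum_filter, sum_const]
  congr 2
  ext r; simp

/-- `dom` and `im` are the domain and the range of a partial injection of the residents which sends
residents of a hospital in `μ` to residents of the same hospital in `ν`, is defined wherever the
cardinalities allow it, and fixes the residents with the same hospital in both. -/
structure IsPairing (μ ν : R → Option H) (dom im : Finset R) : Prop where
  card_dom : ∀ h, #(dom ∩ fiber μ h) = min (#(fiber μ h)) (#(fiber ν h))
  card_im : ∀ h, #(im ∩ fiber ν h) = min (#(fiber μ h)) (#(fiber ν h))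
  dom_ne : ∀ r ∈ dom, μ r ≠ none
  im_ne : ∀ r ∈ im, ν r ≠ none
  mem_dom : ∀ r h, μ r = some h → ν r = some h → r ∈ dom
  mem_im : ∀ r h, μ r = some h → ν r = some h → r ∈ im

/-- At each hospital the required size lies between that of the common residents and that of either
fibre, so intermediate sets exist; fibres of distinct hospitals are disjoint, so the choices can be
glued. -/
lemma exists_isPairing (μ ν : R → Option H) : ∃ dom im, IsPairing μ ν dom im := by
  have h1 : ∀ h, ∃ D, fiber μ h ∩ fiber ν h ⊆ D ∧ D ⊆ fiber μ h ∧
      #D = min (#(fiber μ h)) (#(fiber ν h)) := fun h =>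
    exists_subsuperset_card_eq inter_subset_left
      (le_min (card_le_card inter_subset_left) (card_le_card inter_subset_right)) (min_le_left _ _)
  have h2 : ∀ h, ∃ D, fiber μ h ∩ fiber ν h ⊆ D ∧ D ⊆ fiber ν h ∧
      #D = min (#(fiber μ h)) (#(fiber ν h)) := fun h =>
    exists_subsuperset_card_eq inter_subset_right
      (le_min (card_le_card inter_subset_left) (card_le_card inter_subset_right)) (min_le_right _ _)
  choose D hD1 hD2 hD3 using h1
  choose J hJ1 hJ2 hJ3 using h2
  have key : ∀ (κ : R → Option H) (F : H → Finset R), (∀ h, F h ⊆ fiber κ h) → ∀ h,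
      univ.biUnion F ∩ fiber κ h = F h := by
    intro κ F hF h
    ext r
    simp only [mem_inter, mem_biUnion, mem_univ, true_and, mem_fiber]
    constructor
    · rintro ⟨⟨h', hr⟩, hh⟩
      have := mem_fiber.1 (hF h' hr)
      rw [hh] at this; cases this; exact hr
    · intro hr; exact ⟨⟨h, hr⟩, mem_fiber.1 (hF h hr)⟩
  refine ⟨univ.biUnion D, univ.biUnion J, ?_, ?_, ?_, ?_, ?_, ?_⟩
  · intro h; rw [key μ D hD2, hD3]
  · intro h; rw [key ν J hJ2, hJ3]
  · intro r hr
    obtain ⟨h, -, hr⟩ := mem_biUnion.1 hr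
    simp [mem_fiber.1 (hD2 h hr)]
  · intro r hr
    obtain ⟨h, -, hr⟩ := mem_biUnion.1 hr
    simp [mem_fiber.1 (hJ2 h hr)]
  · intro r h h3 h4
    exact mem_biUnion.2 ⟨h, mem_univ _, hD1 h (by simp [h3, h4])⟩
  · intro r h h3 h4
    exact mem_biUnion.2 ⟨h, mem_univ _, hJ1 h (by simp [h3, h4])⟩

lemma card_eq_sum_inter_fiber {μ : R → Option H} {A : Finset R} (hA : ∀ r ∈ A, μ r ≠ none) :
    #A = ∑ h, #(A ∩ fiber μ h) := by
  have := sum_elim_eq_sum_fiber μ A (fun _ => 1)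
  simp only [smul_eq_mul, mul_one] at this
  rw [← this, card_eq_sum_ones]
  refine sum_congr rfl fun r hr => ?_
  cases h : μ r with
  | none => exact absurd h (hA r hr)
  | some h => rfl

namespace IsPairing

variable {μ ν : R → Option H} {dom im : Finset R}

lemma card_eq (hp : IsPairing μ ν dom im) : #dom = #im := by
  rw [card_eq_sum_inter_fiber hp.dom_ne, card_eq_sum_inter_fiber hp.im_ne]
  exact sum_congr rfl fun h _ => by rw [hp.card_dom, hp.card_im]

lemma card_sdiff_eq (hp : IsPairing μ ν dom im) : #(im \ dom) = #(dom \ im) := by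
  have h1 := card_sdiff_add_card_inter dom im
  have h2 := card_sdiff_add_card_inter im dom
  rw [inter_comm] at h2
  have := hp.card_eq
  omega

lemma card_union (hp : IsPairing μ ν dom im) : #(dom ∪ im) = #dom + #(dom \ im) := by
  rw [← hp.card_sdiff_eq, ← card_union_of_disjoint disjoint_sdiff, union_sdiff_self_eq_union]

/-- The sets `dom \ im` and `im \ dom` are disjoint and equinumerous. -/
lemma two_mul_card_le (hp : IsPairing μ ν dom im) : 2 * #(dom \ im) ≤ Fintype.card R := by
  have h1 := card_sdiff_add_card_inter dom im
  have h2 := hp.card_union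
  have := card_le_univ (dom ∪ im)
  have := card_le_card (sdiff_subset : dom \ im ⊆ dom)
  omega

lemma mem_dom_of_le (hp : IsPairing μ ν dom im) {r : R} {h : H} (hr : μ r = some h)
    (hle : #(fiber μ h) ≤ #(fiber ν h)) : r ∈ dom := by
  have h1 := hp.card_dom h
  rw [min_eq_left hle] at h1
  have := eq_of_subset_of_card_le inter_subset_right h1.ge
  have h2 : r ∈ dom ∩ fiber μ h := by rw [this]; simpa using hr
  exact (mem_inter.1 h2).1

/-- Common residents of `h` belong to `dom`, so a member of `im` in the `μ`-fibre but not in `dom`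
lies outside the `ν`-fibre. The pairs at `h` are then counted once in `dom` and removed once from
`im`. -/
lemma card_inter_fiber_left_le (hp : IsPairing μ ν dom im) (h : H) :
    #((dom ∪ im) ∩ fiber μ h) ≤ #dom := by
  have hsub : (dom ∪ im) ∩ fiber μ h ⊆ (dom ∩ fiber μ h) ∪ (im \ fiber ν h) := by
    intro r hr
    simp only [mem_inter, mem_union, mem_sdiff, mem_fiber] at hr ⊢
    have := hp.mem_dom r h hr.2
    tauto
  have h1 := (card_le_card hsub).trans (card_union_le _ _)
  have h2 := card_sdiff_add_card_inter im (fiber ν h)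
  have := hp.card_dom h
  have := hp.card_im h
  have := hp.card_eq
  omega

lemma card_inter_fiber_right_le (hp : IsPairing μ ν dom im) (h : H) :
    #((dom ∪ im) ∩ fiber ν h) ≤ #dom := by
  have hsub : (dom ∪ im) ∩ fiber ν h ⊆ (im ∩ fiber ν h) ∪ (dom \ fiber μ h) := by
    intro r hr
    simp only [mem_inter, mem_union, mem_sdiff, mem_fiber] at hr ⊢
    have := fun h' => hp.mem_im r h h' hr.2
    tauto
  have h1 := (card_le_card hsub).trans (card_union_le _ _)
  have h2 := card_sdiff_add_card_inter dom (fiber μ h)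
  have := hp.card_dom h
  have := hp.card_im h
  omega

/-- If `S` meets `dom ∪ im` in at most `#dom` elements, many elements of `dom ∪ im` avoid `S`. -/
lemma le_card_sdiff (hp : IsPairing μ ν dom im) {S : Finset R} (hS : #((dom ∪ im) ∩ S) ≤ #dom) :
    #(dom \ im) ≤ #((dom ∪ im) \ S) := by
  have h1 := card_sdiff_add_card_inter (dom ∪ im) S
  have := hp.card_union
  omega

end IsPairing

/-- The relation between the output `μ` of Triple Proposal and a stable assignment `ν` that the
analysis of the approximation factor uses. -/
structure IsComparable (l : H → ℕ) (μ ν : R → Option H) : Prop where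
  lower_le : ∀ h, l h ≤ Fintype.card R
  -- The first alternative comes from a tie between `h` and `h'`, the second from a strict
  -- preference for `h'`.
  assigned : ∀ r h, ν r = some h → #(fiber μ h) < l h → ∃ h', μ r = some h' ∧
    ((l h' ≤ l h ∧ #(fiber μ h') ≤ l h') ∨
      (#(fiber μ h') ≤ #(fiber ν h') ∧ l h' ≤ #(fiber ν h')))
  ne_none : ∀ r h h' b, ν r = some h → #(fiber μ h) < l h → μ r = some h' → h' ≠ h →
    ν b = some h' → μ b ≠ none

/-- The weight of a hospital that is not above its lower quota. -/
noncomputable def lossWeight (l : H → ℕ) (μ : R → Option H) (h : H) : ℝ :=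
  if #(fiber μ h) ≤ l h then 1 / (l h : ℝ) else 0

/-- The weight of a hospital below its lower quota. -/
noncomputable def deficitWeight (l : H → ℕ) (μ : R → Option H) (h : H) : ℝ :=
  if #(fiber μ h) < l h then 1 / (l h : ℝ) else 0

lemma deficitWeight_nonneg (l : H → ℕ) (μ : R → Option H) (h : H) : 0 ≤ deficitWeight l μ h := by
  unfold deficitWeight; split_ifs <;> positivity

lemma lossWeight_nonneg (l : H → ℕ) (μ : R → Option H) (h : H) : 0 ≤ lossWeight l μ h := by
  unfold lossWeight; split_ifs <;> positivity

lemma elim_nonneg {f : H → ℝ} (hf : ∀ h, 0 ≤ f h) (o : Option H) : 0 ≤ o.elim 0 f := by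
  cases o
  · exact le_rfl
  · exact hf _

/-- The hospitals that reach their lower quota. -/
def fullHospitals (l : H → ℕ) (μ : R → Option H) : Finset H :=
  univ.filter fun h => l h ≤ #(fiber μ h)

/-- The ratio of a deficient hospital is spread over its residents, `1/ℓ` each. -/
lemma total_eq (l : H → ℕ) (μ : R → Option H) :
    total l μ = #(fullHospitals l μ) + ∑ r, (μ r).elim 0 (deficitWeight l μ) := by
  rw [sum_elim_eq_sum_fiber, fullHospitals, card_filter]
  push_cast
  rw [← sum_add_distrib]
  refine sum_congr rfl fun h _ => ?_
  unfold deficitWeight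
  by_cases hh : l h ≤ #(fiber μ h)
  · simp [hh, satRatio_of_le]
  · rw [satRatio_of_lt (by omega)]
    simp [hh, not_le.1 hh]; rfl

lemma total_le (l : H → ℕ) (μ ν : R → Option H) :
    total l ν ≤ #(fullHospitals l μ) + ∑ r, (ν r).elim 0 (deficitWeight l μ) := by
  rw [sum_elim_eq_sum_fiber, fullHospitals, card_filter]
  push_cast
  rw [← sum_add_distrib]
  refine sum_le_sum fun h _ => ?_
  unfold deficitWeight
  by_cases hh : l h ≤ #(fiber μ h)
  · simp [hh, not_lt.2 hh, satRatio_le_one]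
  · refine (satRatio_le_div (by omega)).trans ?_
    simp [hh, not_le.1 hh]; rfl

/-- Passing from `a` to `b` residents changes the ratio by at most `1/l` per resident gained, and by
at least `1/l` per resident lost when `a ≤ l`. At `a = l` a loss already costs `1/l` while a gain is
worthless; hence `≤` in one weight and `<` in the other. -/
lemma satRatio_add_le (l a b : ℕ) :
    satRatio l b + (a - min a b : ℝ) * (if a ≤ l then 1 / (l : ℝ) else 0) ≤
      satRatio l a + (b - min a b : ℝ) * (if a < l then 1 / (l : ℝ) else 0) := by
  rcases lt_trichotomy a l with h | h | h
  · rw [if_pos h.le, if_pos h, satRatio_of_lt h]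
    have := satRatio_le_div (l := l) (a := b) (by omega)
    have e : (a - min a b : ℝ) * (1 / (l : ℝ)) + b / l =
      a / l + (b - min a b : ℝ) * (1 / (l : ℝ)) := by ring
    linarith
  · subst h
    simp only [le_refl, if_true, lt_irrefl, if_false, mul_zero, add_zero]
    rw [satRatio_of_le le_rfl]
    rcases Nat.eq_zero_or_pos a with h0 | h0
    · subst h0; simp [satRatio]
    rcases le_total a b with hb | hb
    · rw [min_eq_left (by exact_mod_cast hb)]; simp [satRatio_le_one]
    · rw [min_eq_right (by exact_mod_cast hb)]
      have := satRatio_le_div (l := a) (a := b) h0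
      have h1 : (0 : ℝ) < a := by exact_mod_cast h0
      have e : (b : ℝ) / a + (a - b) * (1 / a) = 1 := by field_simp; ring
      linarith
  · rw [if_neg (by omega), if_neg (by omega), satRatio_of_le h.le]
    simp [satRatio_le_one]

variable {l : H → ℕ} {μ ν : R → Option H} {dom im : Finset R}

lemma IsPairing.total_add_le (hp : IsPairing μ ν dom im) :
    total l ν + ∑ r ∈ univ \ dom, (μ r).elim 0 (lossWeight l μ) ≤
      total l μ + ∑ r ∈ univ \ im, (ν r).elim 0 (deficitWeight l μ) := by
  rw [sum_elim_eq_sum_fiber, sum_elim_eq_sum_fiber]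
  unfold total
  rw [← sum_add_distrib, ← sum_add_distrib]
  refine sum_le_sum fun h _ => ?_
  have e : ∀ A F : Finset R, (#((univ \ A) ∩ F) : ℝ) = #F - #(A ∩ F) := by
    intro A F
    have h1 := card_sdiff_add_card_inter F A
    have h2 : (univ \ A) ∩ F = F \ A := by ext; simp [and_comm]
    rw [h2, inter_comm A, ← h1]; push_cast; ring
  rw [nsmul_eq_mul, nsmul_eq_mul, e, e, hp.card_dom, hp.card_im]
  exact_mod_cast satRatio_add_le (l h) (#(fiber μ h)) (#(fiber ν h))

lemma deficitWeight_le_one (h : H) : deficitWeight l μ h ≤ 1 := by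
  unfold deficitWeight; split_ifs with h1
  · have : (1 : ℝ) ≤ l h := by exact_mod_cast (by omega : 1 ≤ l h)
    exact (div_le_one (by linarith)).2 this
  · exact zero_le_one

lemma fiber_pos {r : R} {h : H} (hr : μ r = some h) : 0 < #(fiber μ h) :=
  card_pos.2 ⟨r, mem_fiber.2 hr⟩

lemma one_div_le_of_le {a b : ℕ} (ha : 0 < a) (h : a ≤ b) : 1 / (b : ℝ) ≤ 1 / (a : ℝ) :=
  one_div_le_one_div_of_le (by exact_mod_cast ha) (by exact_mod_cast h)

/-- Outside `dom ∪ im` the gain of a resident is dominated by her own loss: the second alternative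
of `assigned` would put her in `dom`, and the first compares the two lower quotas. Residents of `dom
\ im` gain at most one each. -/
lemma IsComparable.total_add_loss_le (hc : IsComparable l μ ν) (hp : IsPairing μ ν dom im) :
    total l ν + ∑ r ∈ im \ dom, (μ r).elim 0 (lossWeight l μ) ≤ total l μ + #(dom \ im) := by
  have h1 := hp.total_add_le (l := l)
  have h2 : ∑ r ∈ univ \ dom, (μ r).elim 0 (lossWeight l μ) =
      ∑ r ∈ im \ dom, (μ r).elim 0 (lossWeight l μ) +
      ∑ r ∈ univ \ (dom ∪ im), (μ r).elim 0 (lossWeight l μ) := by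
    rw [← sum_union]
    · congr 1; ext; simp; tauto
    · rw [disjoint_left]; intro r; simp; tauto
  have h3 : ∑ r ∈ univ \ im, (ν r).elim 0 (deficitWeight l μ) =
      ∑ r ∈ dom \ im, (ν r).elim 0 (deficitWeight l μ) +
      ∑ r ∈ univ \ (dom ∪ im), (ν r).elim 0 (deficitWeight l μ) := by
    rw [← sum_union]
    · congr 1; ext; simp; tauto
    · rw [disjoint_left]; intro r; simp; tauto
  have h4 : ∑ r ∈ dom \ im, (ν r).elim 0 (deficitWeight l μ) ≤ #(dom \ im) := by
    rw [card_eq_sum_ones]; push_cast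
    refine sum_le_sum fun r _ => ?_
    cases ν r
    · exact zero_le_one
    · exact deficitWeight_le_one _
  have h5 : ∑ r ∈ univ \ (dom ∪ im), (ν r).elim 0 (deficitWeight l μ) ≤
      ∑ r ∈ univ \ (dom ∪ im), (μ r).elim 0 (lossWeight l μ) := by
    refine sum_le_sum fun r hr => ?_
    have hn := elim_nonneg (lossWeight_nonneg l μ) (μ r)
    cases hν : ν r with
    | none => exact hn
    | some h =>
      by_cases hd : #(fiber μ h) < l h
      · obtain ⟨h', hμ, hT | hS⟩ := hc.assigned r h hν hd
        · have := fiber_pos hμ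
          simp only [hμ, Option.elim, deficitWeight, lossWeight, if_pos hd, if_pos hT.2]
          exact one_div_le_of_le (by omega) hT.1
        · have := hp.mem_dom_of_le hμ hS.1
          simp [this] at hr
      · simpa [deficitWeight, hd] using hn
  linarith

lemma le_of_two_le {n q : ℕ} {s t : ℝ} (hq : 2 * q ≤ n) (hs : 2 ≤ s) (h : t ≤ s + q) :
    t ≤ (2 + (n / 2 : ℕ)) / 2 * s := by
  have : (q : ℝ) ≤ (n / 2 : ℕ) := by exact_mod_cast (by omega : q ≤ n / 2)
  nlinarith

lemma le_of_one_add_le {n q : ℕ} {s t : ℝ} (hn : 1 ≤ n) (hq : 2 * q ≤ n) (hs : 1 + (q : ℝ) / n ≤ s)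
    (h : t + (q : ℝ) / n ≤ s + q) :
    t ≤ n * (1 + (n / 2 : ℕ)) / (n + (n / 2 : ℕ)) * s := by
  have hk : (q : ℝ) ≤ (n / 2 : ℕ) := by exact_mod_cast (by omega : q ≤ n / 2)
  have hn' : (1 : ℝ) ≤ n := by exact_mod_cast hn
  have hq0 : (0 : ℝ) ≤ q := by positivity
  generalize ((n / 2 : ℕ) : ℝ) = k at *
  generalize (q : ℝ) = x at *
  generalize (n : ℝ) = N at *
  have hs0 : 0 ≤ s := le_trans (by positivity) hs
  have h1 : t ≤ N * (1 + x) / (N + x) * s := by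
    rw [div_mul_eq_mul_div, le_div_iff₀ (by positivity)]
    have e1 : N * (x / N) = x := by field_simp
    generalize x / N = y at *
    subst e1
    have hy : 0 ≤ y := by nlinarith
    have h2 : t * (N + N * y) ≤ (s + N * y - y) * (N + N * y) :=
      mul_le_mul_of_nonneg_right (by linarith) (by positivity)
    -- This product is exactly the slack between the bound of `h2` and the goal after clearing
    -- denominators.
    have h3 : 0 ≤ (s - (1 + y)) * (N * y * (N - 1)) :=
      mul_nonneg (by linarith) (by have : 0 ≤ N - 1 := by linarith
                                   positivity)
    nlinarith
  refine h1.trans (mul_le_mul_of_nonneg_right ?_ hs0)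
  rw [div_le_div_iff₀ (by positivity) (by linarith)]
  have : 0 ≤ (k - x) * (N * (N - 1)) :=
    mul_nonneg (by linarith) (mul_nonneg (by linarith) (by linarith))
  nlinarith

/-- For `n ≥ 3` the first bound is the smaller because `⌊n/2⌋ + 2 ≤ n`. This fails for `n = 2`,
where the first bound `3/2` exceeds the second, `4/3`. -/
lemma le_phi {n : ℕ} (hn : 1 ≤ n) : (2 + ((n / 2 : ℕ) : ℝ)) / 2 ≤ phi n ∧
    (n : ℝ) * (1 + ((n / 2 : ℕ) : ℝ)) / (n + ((n / 2 : ℕ) : ℝ)) ≤ phi n := by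
  unfold phi
  split_ifs with h1 h2
  · subst h1; norm_num
  · subst h2; norm_num
  · refine ⟨?_, le_rfl⟩
    have hk : ((n / 2 : ℕ) : ℝ) + 2 ≤ n := by exact_mod_cast (by omega : n / 2 + 2 ≤ n)
    have hk0 : (0 : ℝ) ≤ ((n / 2 : ℕ) : ℝ) := Nat.cast_nonneg _
    rw [div_le_div_iff₀ (by norm_num) (by linarith)]
    nlinarith

lemma one_le_phi {n : ℕ} (hn : 1 ≤ n) : 1 ≤ phi n := by
  refine le_trans ?_ (le_phi hn).1
  have hk0 : (0 : ℝ) ≤ ((n / 2 : ℕ) : ℝ) := Nat.cast_nonneg _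
  linarith

lemma sum_ge_card_div {f : R → ℝ} {A : Finset R} {n : ℕ} (hf : ∀ r ∈ A, 1 / (n : ℝ) ≤ f r) :
    (#A : ℝ) / n ≤ ∑ r ∈ A, f r := by
  have := card_nsmul_le_sum A f _ hf
  rw [nsmul_eq_mul] at this
  rwa [div_eq_mul_one_div]

lemma IsComparable.one_div_le (hc : IsComparable l μ ν) {h : H} (hh : 0 < l h) :
    1 / (Fintype.card R : ℝ) ≤ 1 / (l h : ℝ) :=
  one_div_le_of_le hh (hc.lower_le h)

lemma IsComparable.one_div_le_deficit (hc : IsComparable l μ ν) {r : R} {h : H} (hr : μ r = some h)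
    (hh : #(fiber μ h) < l h) :
    1 / (Fintype.card R : ℝ) ≤ (μ r).elim 0 (deficitWeight l μ) := by
  simp only [hr, Option.elim, deficitWeight, if_pos hh]
  exact hc.one_div_le (by omega)

lemma IsComparable.one_div_le_loss (hc : IsComparable l μ ν) {r : R} {h : H} (hr : μ r = some h)
    (hh : #(fiber μ h) ≤ l h) :
    1 / (Fintype.card R : ℝ) ≤ (μ r).elim 0 (lossWeight l μ) := by
  have := fiber_pos hr
  simp only [hr, Option.elim, lossWeight, if_pos hh]
  exact hc.one_div_le (by omega)

/-- The case of a resident moving from a hospital that reaches its lower quota to a deficient one,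
when only one hospital reaches its lower quota. -/
lemma IsComparable.bound_of_unique_full (hc : IsComparable l μ ν) (hp : IsPairing μ ν dom im)
    {r : R} {h h' : H} (hν : ν r = some h) (hd : #(fiber μ h) < l h) (hμ : μ r = some h')
    (hf : l h' ≤ #(fiber μ h')) (hu : ∀ g, l g ≤ #(fiber μ g) → g = h') :
    1 + (#(dom \ im) : ℝ) / Fintype.card R ≤ total l μ ∧
      (#(dom \ im) : ℝ) / Fintype.card R ≤
        ∑ r ∈ im \ dom, (μ r).elim 0 (lossWeight l μ) := by
  have hne : h' ≠ h := by rintro rfl; omega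
  -- A member of `im` sits in `ν` either at `h'`, where `ne_none` applies, or at a deficient
  -- hospital, where `assigned` does.
  have hmatched : ∀ b ∈ dom ∪ im, ∃ g, μ b = some g := by
    intro b hb
    rw [← Option.ne_none_iff_exists']
    rcases mem_union.1 hb with hb | hb
    · exact hp.dom_ne b hb
    · obtain ⟨g, hg⟩ := Option.ne_none_iff_exists'.1 (hp.im_ne b hb)
      by_cases hgf : l g ≤ #(fiber μ g)
      · rw [hu g hgf] at hg
        exact hc.ne_none r h h' b hν hd hμ hne hg
      · obtain ⟨g', hg', -⟩ := hc.assigned b g hg (by omega)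
        simp [hg']
  constructor
  · rw [total_eq]
    have h1 : (1 : ℝ) ≤ #(fullHospitals l μ) := by
      exact_mod_cast card_pos.2 ⟨h', by simp [fullHospitals, hf]⟩
    have h2 : (#((dom ∪ im) \ fiber μ h') : ℝ) / Fintype.card R ≤
        ∑ r ∈ (dom ∪ im) \ fiber μ h', (μ r).elim 0 (deficitWeight l μ) := by
      refine sum_ge_card_div fun b hb => ?_
      rw [mem_sdiff, mem_fiber] at hb
      obtain ⟨g, hg⟩ := hmatched b hb.1
      refine hc.one_div_le_deficit hg ?_
      by_contra hh
      exact hb.2 (by rw [hg, hu g (by omega)])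
    have h3 := sum_le_univ_sum_of_nonneg (s := (dom ∪ im) \ fiber μ h')
      (fun r => elim_nonneg (deficitWeight_nonneg l μ) (μ r))
    have h4 : (#(dom \ im) : ℝ) / Fintype.card R ≤
        (#((dom ∪ im) \ fiber μ h') : ℝ) / Fintype.card R := by
      refine div_le_div_of_nonneg_right (Nat.cast_le.2 ?_) (Nat.cast_nonneg _)
      exact hp.le_card_sdiff (hp.card_inter_fiber_left_le h')
    linarith
  · rw [← hp.card_sdiff_eq]
    refine sum_ge_card_div fun b hb => ?_
    rw [mem_sdiff] at hb
    obtain ⟨g, hg⟩ := hmatched b (mem_union_right _ hb.1)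
    refine hc.one_div_le_loss hg ?_
    by_cases hgf : l g ≤ #(fiber μ g)
    · obtain rfl := hu g hgf
      -- The moving resident `r` forces `h'` not to exceed its lower quota: otherwise `ν` has at
      -- least as many residents there as `μ`, and all of the `μ`-fibre, including `b`, would be in
      -- `dom`.
      obtain ⟨g', hg', hT | hS⟩ := hc.assigned r h hν hd
      · rw [hμ] at hg'; cases hg'; exact hT.2
      · rw [hμ] at hg'; cases hg'
        exact absurd (hp.mem_dom_of_le hg hS.1) hb.2
    · omega

/-- The case of no resident moving from a hospital that reaches its lower quota to a deficient one.
Unless every resident of a deficient hospital loses nothing, the residents of some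
hospital in `ν` have total weight at least one in `μ`. -/
lemma IsComparable.le_or_exists (hc : IsComparable l μ ν)
    (hX : ∀ r h h', ν r = some h → #(fiber μ h) < l h → μ r = some h' → #(fiber μ h') < l h') :
    total l ν ≤ total l μ ∨ ∃ h, 1 ≤ ∑ r ∈ fiber ν h, (μ r).elim 0 (deficitWeight l μ) := by
  -- The possible values of `h'` in the second alternative of `assigned`. For a member `h` of
  -- maximum lower quota, each of its at least `ℓ(h)` residents in `ν` has weight at least `1/ℓ(h)`
  -- in `μ`; if there is no member, only the first alternative occurs.
  set Z : Finset H := univ.filter fun h' => #(fiber μ h') < l h' ∧ l h' ≤ #(fiber ν h') ∧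
    ∃ r, μ r = some h' with hZ
  by_cases hZe : Z.Nonempty
  · right
    obtain ⟨h, hh, hmax⟩ := exists_max_image Z l hZe
    have hhZ := hh
    rw [hZ, mem_filter] at hh
    refine ⟨h, ?_⟩
    have hl : 0 < l h := by omega
    have h1 : ∀ r ∈ fiber ν h, 1 / (l h : ℝ) ≤ (μ r).elim 0 (deficitWeight l μ) := by
      intro r hr
      rw [mem_fiber] at hr
      obtain ⟨h', hμ, hor⟩ := hc.assigned r h hr hh.2.1
      have hd := hX r h h' hr hh.2.1 hμ
      simp only [hμ, Option.elim, deficitWeight, if_pos hd]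
      refine one_div_le_of_le (by omega) ?_
      rcases hor with hT | hS
      · exact hT.1
      · exact hmax h' (by rw [hZ, mem_filter]; exact ⟨mem_univ _, hd, hS.2, r, hμ⟩)
    refine le_trans ?_ (sum_ge_card_div h1)
    rw [le_div_iff₀ (by exact_mod_cast hl), one_mul]
    exact_mod_cast hh.2.2.1
  · left
    rw [total_eq l μ]
    refine (total_le l μ ν).trans ?_
    gcongr with r
    have hn := elim_nonneg (deficitWeight_nonneg l μ) (μ r)
    cases hν : ν r with
    | none => exact hn
    | some h =>
      by_cases hd : #(fiber μ h) < l h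
      · obtain ⟨h', hμ, hor⟩ := hc.assigned r h hν hd
        have hd' := hX r h h' hν hd hμ
        simp only [hμ, Option.elim, deficitWeight, if_pos hd, if_pos hd']
        refine one_div_le_of_le (by omega) ?_
        rcases hor with hT | hS
        · exact hT.1
        · exact absurd ⟨h', by rw [hZ, mem_filter]; exact ⟨mem_univ _, hd', hS.2, r, hμ⟩⟩ hZe
      · simpa [deficitWeight, hd] using hn

/-- The approximation bound. -/
lemma IsComparable.total_le_phi (hc : IsComparable l μ ν) (hn : 1 ≤ Fintype.card R) :
    total l ν ≤ phi (Fintype.card R) * total l μ := by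
  obtain ⟨dom, im, hp⟩ := exists_isPairing μ ν
  have hloss := hc.total_add_loss_le hp
  have hloss0 : 0 ≤ ∑ r ∈ im \ dom, (μ r).elim 0 (lossWeight l μ) :=
    sum_nonneg fun r _ => elim_nonneg (lossWeight_nonneg l μ) _
  have hw0 : ∀ r, 0 ≤ (μ r).elim 0 (deficitWeight l μ) :=
    fun r => elim_nonneg (deficitWeight_nonneg l μ) _
  have hs0 : 0 ≤ total l μ := sum_nonneg fun h _ => satRatio_nonneg _ _
  have hq := hp.two_mul_card_le
  by_cases h2 : 2 ≤ total l μ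
  · exact (le_of_two_le hq h2 (by linarith)).trans
      (mul_le_mul_of_nonneg_right (le_phi hn).1 hs0)
  suffices hsuff : total l ν ≤ total l μ ∨ 1 + (#(dom \ im) : ℝ) / Fintype.card R ≤ total l μ ∧
      (#(dom \ im) : ℝ) / Fintype.card R ≤ ∑ r ∈ im \ dom, (μ r).elim 0 (lossWeight l μ) by
    rcases hsuff with h | ⟨h3, h4⟩
    · nlinarith [one_le_phi hn]
    · exact (le_of_one_add_le hn hq h3 (by linarith)).trans
        (mul_le_mul_of_nonneg_right (le_phi hn).2 hs0)
  have hfull : #(fullHospitals l μ) ≤ 1 := by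
    by_contra hcon
    have h3 : (2 : ℝ) ≤ #(fullHospitals l μ) := by exact_mod_cast (by omega)
    rw [total_eq] at h2
    exact h2 (by linarith [sum_nonneg fun r (_ : r ∈ univ) => hw0 r])
  by_cases hX : ∃ r h h', ν r = some h ∧ #(fiber μ h) < l h ∧ μ r = some h' ∧ l h' ≤ #(fiber μ h')
  · obtain ⟨r, h, h', hν, hd, hμ, hf⟩ := hX
    refine Or.inr (hc.bound_of_unique_full hp hν hd hμ hf fun g hg => ?_)
    exact card_le_one.1 hfull g (by simpa [fullHospitals] using hg) h'
      (by simpa [fullHospitals] using hf)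
  · push Not at hX
    rcases hc.le_or_exists hX with h | ⟨h, hh⟩
    · exact Or.inl h
    right
    -- The residents of `ν` at `h` already carry weight one in deficient hospitals, so a hospital
    -- reaching its quota would give `s ≥ 2`.
    have hfull0 : #(fullHospitals l μ) = 0 := by
      by_contra hcon
      have h3 : (1 : ℝ) ≤ #(fullHospitals l μ) := by exact_mod_cast (by omega)
      rw [total_eq] at h2
      exact h2 (by linarith [sum_le_univ_sum_of_nonneg (s := fiber ν h) hw0])
    have hdef : ∀ g, #(fiber μ g) < l g := by
      rw [card_eq_zero, fullHospitals, filter_eq_empty_iff] at hfull0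
      exact fun g => not_le.1 (hfull0 (mem_univ g))
    have hmatched : ∀ b ∈ dom ∪ im, ∃ g, μ b = some g := by
      intro b hb
      rcases mem_union.1 hb with hb | hb
      · exact Option.ne_none_iff_exists'.1 (hp.dom_ne b hb)
      · obtain ⟨g, hg⟩ := Option.ne_none_iff_exists'.1 (hp.im_ne b hb)
        obtain ⟨g', hg', -⟩ := hc.assigned b g hg (hdef g)
        exact ⟨g', hg'⟩
    constructor
    -- At least `q` further residents lie outside this fibre, each with weight at least `1/n`.
    · have h3 : (#((dom ∪ im) \ fiber ν h) : ℝ) / Fintype.card R ≤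
          ∑ r ∈ (dom ∪ im) \ fiber ν h, (μ r).elim 0 (deficitWeight l μ) := by
        refine sum_ge_card_div fun b hb => ?_
        obtain ⟨g, hg⟩ := hmatched b (mem_sdiff.1 hb).1
        exact hc.one_div_le_deficit hg (hdef g)
      have h4 : (#(dom \ im) : ℝ) / Fintype.card R ≤
          (#((dom ∪ im) \ fiber ν h) : ℝ) / Fintype.card R := by
        refine div_le_div_of_nonneg_right (Nat.cast_le.2 ?_) (Nat.cast_nonneg _)
        exact hp.le_card_sdiff (hp.card_inter_fiber_right_le h)
      have h5 := sum_le_univ_sum_of_nonneg (s := fiber ν h ∪ (dom ∪ im) \ fiber ν h) hw0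
      rw [sum_union disjoint_sdiff] at h5
      rw [total_eq, hfull0]
      push_cast
      linarith
    · rw [← hp.card_sdiff_eq]
      refine sum_ge_card_div fun b hb => ?_
      obtain ⟨g, hg⟩ := hmatched b (mem_union_right _ (mem_sdiff.1 hb).1)
      exact hc.one_div_le_loss hg (hdef g).le

end Ratio

/-! ### Invariants, termination and stability of Triple Proposal -/

section Algorithm

open Finset

variable {n m : ℕ} {I : Instance n m} {c c' : Config n m} {M : Finset (Fin n × Fin m)}
  {r r' : Fin n} {h h' : Fin m}

@[simp] lemma mem_assigned : r ∈ assigned M h ↔ (r, h) ∈ M := by simp [assigned]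

@[simp] lemma mem_hospitalsOf : h ∈ hospitalsOf M r ↔ (r, h) ∈ M := by simp [hospitalsOf]

@[simp] lemma mem_fullList : h ∈ fullList I r ↔ (r, h) ∈ I.E := by simp [fullList]

@[simp] lemma mem_candidates : r' ∈ candidates c r h ↔ r' = r ∨ (r', h) ∈ c.M := by
  simp [candidates]

lemma mem_topTie : h ∈ topTie I c r ↔
    h ∈ c.list r ∧ ∀ h' ∈ c.list r, I.resRank r h ≤ I.resRank r h' := by simp [topTie]

lemma Active.not_mem (ha : Active c r) (h : Fin m) : (r, h) ∉ c.M := by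
  rw [← mem_hospitalsOf, ha.1]; simp

lemma assigned_insert_of_ne (hne : h' ≠ h) : assigned (insert (r, h) M) h' = assigned M h' := by
  ext x; simp [hne]

lemma assigned_insert : assigned (insert (r, h) M) h = insert r (assigned M h) := by
  ext x; simp

lemma card_assigned_insert (hr : (r, h) ∉ M) :
    #(assigned (insert (r, h) M) h) = #(assigned M h) + 1 := by
  rw [assigned_insert, card_insert_of_notMem (by simpa using hr)]

lemma card_assigned_le_insert (r : Fin n) (h h' : Fin m) :
    #(assigned M h') ≤ #(assigned (insert (r, h) M) h') :=
  card_le_card fun x => by simp only [mem_assigned, mem_insert]; exact Or.inr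

lemma card_assigned_erase_insert (hr : (r, h) ∉ M) (hr' : r' = r ∨ (r', h) ∈ M) (h' : Fin m) :
    #(assigned ((insert (r, h) M).erase (r', h)) h') = #(assigned M h') := by
  by_cases hne : h' = h
  · subst hne
    have e : assigned ((insert (r, h') M).erase (r', h')) h' =
        (assigned (insert (r, h') M) h').erase r' := by ext x; simp
    rw [e, card_erase_of_mem (by simpa using hr'), card_assigned_insert hr, Nat.add_sub_cancel]
  · congr 1; ext x; simp [hne]

/-- The invariants of Triple Proposal. -/
structure Inv (I : Instance n m) (c : Config n m) : Prop where
  unique : ∀ r h h', (r, h) ∈ c.M → (r, h') ∈ c.M → h = h'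
  upper : ∀ h, #(assigned c.M h) ≤ I.upper h
  mem_list : ∀ r h, h ∈ c.list r → (r, h) ∈ I.E
  list_nonempty : ∀ r h, (r, h) ∈ I.E → (c.list r).Nonempty
  matched : ∀ r h, (r, h) ∈ c.M →
    h ∈ c.list r ∧ (∀ h' ∈ c.list r, I.resRank r h ≤ I.resRank r h') ∧ c.state r ≤ 1
  proposed : ∀ p, p ∈ c.proposed ↔ p ∈ c.rejected ∨ p ∈ c.M
  lower_le : ∀ r h, (r, h) ∈ c.rejected → I.lower h ≤ #(assigned c.M h)
  rejected_of_lt : ∀ r h, I.lower h < #(assigned c.M h) → (r, h) ∈ c.M → (r, h) ∈ c.rejected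
  not_proposed : ∀ r h h', (r, h) ∈ c.M → h' ∈ c.list r → I.resRank r h' = I.resRank r h →
    (r, h') ∉ c.proposed → I.lower h ≤ I.lower h' ∧ (r, h) ∉ c.rejected
  -- The number `s` is the round in which `h` was deleted. Stability needs `s = 0`; the comparison
  -- of states at `s = 1` is what yields `ne_none`.
  deleted : ∀ r h s, (r, h) ∈ I.E → (s < c.state r ∨ s = c.state r ∧ h ∉ c.list r) →
    I.upper h ≤ #(assigned c.M h) ∧ ∀ x, (x, h) ∈ c.M → (x, h) ∈ c.rejected ∧
      (I.hospRank h x < I.hospRank h r ∨ I.hospRank h x = I.hospRank h r ∧ s ≤ c.state x)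

lemma inv_init (I : Instance n m) : Inv I (initConfig I) where
  unique := by simp [initConfig]
  upper := by simp [initConfig, assigned]
  mem_list := by simp [initConfig]
  list_nonempty := fun r h hE => ⟨h, by simpa [initConfig] using hE⟩
  matched := by simp [initConfig]
  proposed := by simp [initConfig]
  lower_le := by simp [initConfig]
  rejected_of_lt := by simp [initConfig]
  not_proposed := by simp [initConfig]
  deleted := by simp +contextual [initConfig]

/-- What the invariants need to know about a proposal. -/
lemma MayPropose.spec (hp : MayPropose I c r h) : (∀ h', (r, h') ∉ c.M) ∧ h ∈ c.list r ∧
    (∀ h' ∈ c.list r, I.resRank r h ≤ I.resRank r h') ∧ c.state r ≤ 1 ∧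
    ∀ h' ∈ c.list r, I.resRank r h' = I.resRank r h → (r, h') ∉ c.proposed →
      I.lower h ≤ I.lower h' ∧ (r, h) ∉ c.proposed := by
  obtain ⟨ha, ht, hor⟩ := hp
  rw [mem_topTie] at ht
  refine ⟨ha.not_mem, ht.1, ht.2, ha.2.2, fun h' hl he hn => ?_⟩
  have ht' : h' ∈ topTie I c r := mem_topTie.2 ⟨hl, fun x hx => he ▸ ht.2 x hx⟩
  rcases hor with ⟨h1, h2⟩ | ⟨h1, -⟩
  · exact ⟨h2 h' ht' hn, h1⟩
  · exact absurd (h1 h' ht') hn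

lemma Inv.accept (hi : Inv I c) (hp : MayPropose I c r h) (hu : #(assigned c.M h) < I.upper h)
    (ho : #(assigned c.M h) < I.lower h ∨ ∀ x ∈ candidates c r h, (x, h) ∈ c.rejected) :
    Inv I { c with M := insert (r, h) c.M, proposed := insert (r, h) c.proposed } := by
  obtain ⟨hn, hl, ht, hs, hf⟩ := hp.spec
  have hcard := card_assigned_insert (hn h)
  have hcardle := card_assigned_le_insert (M := c.M) r h
  constructor
  · intro x y y' h1 h2
    have := hi.unique x y y'
    grind
  · intro y
    by_cases hy : y = h
    · subst hy; dsimp only; omega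
    · dsimp only; rw [assigned_insert_of_ne hy]; exact hi.upper y
  · exact hi.mem_list
  · exact hi.list_nonempty
  · intro x y h1
    have := hi.matched x y
    grind
  · intro p
    have := hi.proposed p
    grind
  · intro x y h1
    exact (hi.lower_le x y h1).trans (hcardle y)
  · intro x y h1 h2
    dsimp only at h1 h2 ⊢
    by_cases hy : y = h
    · subst hy
      rcases ho with ho | ho
      · omega
      · exact ho x (by simpa using h2)
    · rw [assigned_insert_of_ne hy] at h1
      exact hi.rejected_of_lt x y h1 (by simpa [hy] using h2)
  · intro x y y' h1 h2 h3 h4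
    have h5 := hi.not_proposed x y y'
    have h6 := hi.proposed (x, y)
    grind
  · intro x y s h1 h2
    have h3 := hi.deleted x y s h1 h2
    -- A hospital that has deleted a resident is full, whereas `h` has a free place.
    have hy : y ≠ h := by rintro rfl; omega
    refine ⟨h3.1.trans (hcardle y), fun z hz => h3.2 z ?_⟩
    simpa [hy] using hz

lemma Inv.rejectFirst (hi : Inv I c) (hp : MayPropose I c r h)
    (hlow : I.lower h ≤ #(assigned c.M h)) (hr' : r' ∈ candidates c r h)
    (hfresh : (r', h) ∉ c.rejected) :
    Inv I { c with
      M := (insert (r, h) c.M).erase (r', h)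
      proposed := insert (r, h) c.proposed
      rejected := insert (r', h) c.rejected } := by
  obtain ⟨hn, hl, ht, hs, hf⟩ := hp.spec
  rw [mem_candidates] at hr'
  have hcard := card_assigned_erase_insert (hn h) hr'
  constructor
  · intro x y y' h1 h2
    have := hi.unique x y y'
    grind
  · intro y
    dsimp only; rw [hcard]; exact hi.upper y
  · exact hi.mem_list
  · exact hi.list_nonempty
  · intro x y h1
    have := hi.matched x y
    grind
  · intro p
    have := hi.proposed p
    grind
  · intro x y h1
    have := hi.lower_le x y
    dsimp only at h1 ⊢; rw [hcard]
    grind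
  · intro x y h1 h2
    dsimp only at h1 h2 ⊢
    rw [hcard] at h1
    have h3 := hi.rejected_of_lt x y h1
    have h4 := hi.rejected_of_lt r' y h1
    grind
  · intro x y y' h1 h2 h3 h4
    have h5 := hi.not_proposed x y y'
    have h6 := hi.proposed (x, y)
    grind
  · intro x y s h1 h2
    have h3 := hi.deleted x y s h1 h2
    dsimp only
    rw [hcard]
    refine ⟨h3.1, fun z hz => ?_⟩
    have h4 := h3.2 z
    -- If `h` had made a deletion, all its residents would have been rejected already, so the fresh
    -- `r'` could only be the proposer and `M` would be unchanged.
    have h5 := h3.2 r'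
    grind

lemma Inv.rejectWorst (hi : Inv I c) (hp : MayPropose I c r h)
    (hlow : I.lower h ≤ #(assigned c.M h))
    (hold : ∀ x ∈ candidates c r h, (x, h) ∈ c.rejected)
    (hupp : I.upper h ≤ #(assigned c.M h)) (hr' : IsVictim I c r h r') :
    Inv I { M := (insert (r, h) c.M).erase (r', h)
            proposed := insert (r, h) c.proposed
            rejected := insert (r', h) c.rejected
            list := Function.update c.list r'
              (if (c.list r').erase h = ∅ then fullList I r' else (c.list r').erase h)
            state := Function.update c.state r'
              (if (c.list r').erase h = ∅ then c.state r' + 1 else c.state r') } := by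
  obtain ⟨hn, hl, ht, hs, hf⟩ := hp.spec
  obtain ⟨hc, hworst, hmin⟩ := hr'
  have hrej := hold r' hc
  simp only [mem_candidates] at hc hworst hmin hold
  have hcard := card_assigned_erase_insert (hn h) hc
  have hlr' : h ∈ c.list r' := by
    rcases hc with rfl | hc
    · exact hl
    · exact (hi.matched _ _ hc).1
  have hM : ∀ x y, (x, y) ∈ (insert (r, h) c.M).erase (r', h) →
      x ≠ r' ∧ ((x = r ∧ y = h) ∨ (x, y) ∈ c.M) := by
    intro x y hx
    have := hi.unique x y h
    grind
  have hstate : ∀ x, c.state x ≤ Function.update c.state r'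
      (if (c.list r').erase h = ∅ then c.state r' + 1 else c.state r') x := by
    intro x
    by_cases hx : x = r'
    · subst hx; rw [Function.update_self]; split_ifs <;> omega
    · rw [Function.update_of_ne hx]
  constructor
  · intro x y y' h1 h2
    have := hi.unique x y y'
    grind
  · intro y
    dsimp only; rw [hcard]; exact hi.upper y
  · intro x y
    dsimp only
    by_cases hx : x = r'
    · subst hx; rw [Function.update_self]
      split_ifs
      · simp
      · intro hy; exact hi.mem_list _ _ (mem_of_mem_erase hy)
    · rw [Function.update_of_ne hx]; exact hi.mem_list x y
  · intro x y hE
    dsimp only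
    by_cases hx : x = r'
    · subst hx; rw [Function.update_self]
      split_ifs with h0
      · exact ⟨y, by simpa using hE⟩
      · exact nonempty_iff_ne_empty.2 h0
    · rw [Function.update_of_ne hx]; exact hi.list_nonempty x y hE
  · intro x y h1
    obtain ⟨h2, h3⟩ := hM x y h1
    dsimp only
    rw [Function.update_of_ne h2, Function.update_of_ne h2]
    rcases h3 with ⟨rfl, rfl⟩ | h3
    · exact ⟨hl, ht, hs⟩
    · exact hi.matched x y h3
  · intro p
    have := hi.proposed p
    grind
  · intro x y h1
    have := hi.lower_le x y
    dsimp only at h1 ⊢; rw [hcard]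
    grind
  · intro x y h1 h2
    obtain ⟨h3, h4⟩ := hM x y h2
    dsimp only at h1 ⊢
    rw [hcard] at h1
    rw [mem_insert]; right
    rcases h4 with ⟨rfl, rfl⟩ | h4
    · exact hold _ (Or.inl rfl)
    · exact hi.rejected_of_lt x y h1 h4
  · intro x y y' h1 h2 h3 h4
    obtain ⟨h5, h6⟩ := hM x y h1
    dsimp only at h2 h4 ⊢
    rw [Function.update_of_ne h5] at h2
    have h7 := hi.not_proposed x y y'
    have h8 := hi.proposed (x, y)
    grind
  · intro x y s hE hor
    dsimp only at hor ⊢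
    rw [hcard]
    -- either the pair was deleted before, or it is the pair deleted now
    have hcase : (s < c.state x ∨ s = c.state x ∧ y ∉ c.list x) ∨
        (x = r' ∧ y = h ∧ s = c.state r') := by
      by_cases hx : x = r'
      · subst hx
        rw [Function.update_self, Function.update_self] at hor
        by_cases h0 : (c.list x).erase h = ∅
        · rw [if_pos h0, if_pos h0] at hor
          -- When the list is restored, the round just completed is `s = c.state x`; its last
          -- remaining hospital is `h`.
          have : y ∈ c.list x → y = h := fun hy => by
            by_contra hne
            have : y ∈ (c.list x).erase h := mem_erase.2 ⟨hne, hy⟩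
            simp [h0] at this
          have hfull : y ∈ fullList I x := by simpa using hE
          grind
        · rw [if_neg h0, if_neg h0] at hor
          grind
      · rw [Function.update_of_ne hx, Function.update_of_ne hx] at hor
        exact Or.inl hor
    rcases hcase with hcase | ⟨rfl, rfl, rfl⟩
    · obtain ⟨h1, h2⟩ := hi.deleted x y s hE hcase
      refine ⟨h1, fun z hz => ?_⟩
      obtain ⟨h3, h4⟩ := hM z y hz
      rw [Function.update_of_ne h3]
      rcases h4 with ⟨rfl, rfl⟩ | h4
      · refine ⟨mem_insert_of_mem (hold _ (Or.inl rfl)), ?_⟩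
        have h5 := hworst z (Or.inl rfl)
        have h6 := hmin z (Or.inl rfl)
        -- The new resident `z` replaces the victim `r'`, who satisfied the comparison with `x`;
        -- since `r'` was worst with minimum state, `z` inherits it.
        have h7 := h2 r' (by grind)
        omega
      · exact ⟨mem_insert_of_mem (h2 z h4).1, (h2 z h4).2⟩
    · refine ⟨hupp, fun z hz => ?_⟩
      obtain ⟨h3, h4⟩ := hM z y hz
      rw [Function.update_of_ne h3]
      have h5 : z = r ∨ (z, y) ∈ c.M := by tauto
      have h6 := hworst z h5
      have h7 := hmin z h5
      exact ⟨mem_insert_of_mem (hold z h5), by omega⟩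

lemma Inv.step (hi : Inv I c) (hs : Step I c c') : Inv I c' := by
  cases hs with
  | acceptLower r h hp hlow =>
    exact hi.accept hp (hlow.trans_le (I.lower_le_upper h)) (Or.inl hlow)
  | rejectFirst r h r' hp hlow hr' hf => exact hi.rejectFirst hp hlow hr' hf
  | acceptUpper r h hp hlow ho hu => exact hi.accept hp hu (Or.inr ho)
  | rejectWorst r h r' hp hlow ho hu hr' => exact hi.rejectWorst hp hlow ho hu hr'

/-! ### Termination -/

/-- A quantity that every rejection decreases and no step increases. -/
def rejectionPotential (c : Config n m) : ℕ :=
  #(univ \ c.rejected) + ∑ r, ((2 - c.state r) * (m + 1) + #(c.list r))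

/-- A quantity that every step decreases. -/
def potential (c : Config n m) : ℕ :=
  (n * m + 1) * rejectionPotential c + (n * m - #c.M)

lemma card_le_mul (M : Finset (Fin n × Fin m)) : #M ≤ n * m := by
  simpa using card_le_univ M

lemma potential_lt_of_accept (hr : (r, h) ∉ c.M) (P : Finset (Fin n × Fin m)) :
    potential { c with M := insert (r, h) c.M, proposed := P } < potential c := by
  have h1 := card_le_mul (insert (r, h) c.M)
  have h2 := card_insert_of_notMem hr
  unfold potential rejectionPotential
  dsimp only
  omega

lemma potential_lt_of_reject (hr : rejectionPotential c' < rejectionPotential c) :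
    potential c' < potential c := by
  unfold potential
  have : (n * m + 1) * rejectionPotential c' + (n * m + 1) ≤
      (n * m + 1) * rejectionPotential c := by
    rw [← Nat.mul_succ]; exact Nat.mul_le_mul_left _ hr
  omega

/-- Acceptances enlarge `M`. A first rejection enlarges `rejected`; a later one shortens a list, or
raises a state, where the factor `m + 1` outweighs the restored list of at most `m` hospitals. The
factor `n * m + 1` makes rejections dominate the size of `M`. -/
lemma Inv.potential_lt (hi : Inv I c) (hs : Step I c c') : potential c' < potential c := by
  cases hs with
  | acceptLower r h hp hlow => exact potential_lt_of_accept (hp.spec.1 h) _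
  | acceptUpper r h hp hlow ho hu => exact potential_lt_of_accept (hp.spec.1 h) _
  | rejectFirst r h r' hp hlow hr' hf =>
    refine potential_lt_of_reject (Nat.add_lt_add_right (card_lt_card ?_) _)
    rw [ssubset_iff_of_subset (sdiff_subset_sdiff subset_rfl (subset_insert _ _))]
    exact ⟨(r', h), by simpa using hf, by simp⟩
  | rejectWorst r h r' hp hlow ho hu hr' =>
    refine potential_lt_of_reject (Nat.add_lt_add_of_le_of_lt
      (card_le_card (sdiff_subset_sdiff subset_rfl (subset_insert _ _))) ?_)
    obtain ⟨hn, hl, ht, hs, -⟩ := hp.spec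
    have hlr' : h ∈ c.list r' ∧ c.state r' ≤ 1 := by
      rcases mem_candidates.1 hr'.1 with rfl | hc
      · exact ⟨hl, hs⟩
      · exact ⟨(hi.matched _ _ hc).1, (hi.matched _ _ hc).2.2⟩
    have hpos := card_pos.2 ⟨h, hlr'.1⟩
    refine sum_lt_sum (fun x _ => ?_) ⟨r', mem_univ _, ?_⟩
    all_goals dsimp only
    · by_cases hx : x = r'
      · subst hx
        rw [Function.update_self, Function.update_self]
        split_ifs with h0
        · have : #(fullList I x) ≤ m := by simpa using card_le_univ (fullList I x)
          obtain ⟨k, hk⟩ : ∃ k, 2 - c.state x = k + 1 := ⟨1 - c.state x, by omega⟩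
          have hk' : 2 - (c.state x + 1) = k := by omega
          rw [hk, hk', Nat.succ_mul]
          omega
        · exact Nat.add_le_add_left (card_le_card (erase_subset _ _)) _
      · rw [Function.update_of_ne hx, Function.update_of_ne hx]
    · rw [Function.update_self, Function.update_self]
      split_ifs with h0
      · have : #(fullList I r') ≤ m := by simpa using card_le_univ (fullList I r')
        obtain ⟨k, hk⟩ : ∃ k, 2 - c.state r' = k + 1 := ⟨1 - c.state r', by omega⟩
        have hk' : 2 - (c.state r' + 1) = k := by omega
        rw [hk, hk', Nat.succ_mul]
        omega
      · exact Nat.add_lt_add_left (card_erase_lt_of_mem hlr'.1) _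

lemma exists_mayPropose (ha : Active c r) : ∃ h, MayPropose I c r h := by
  obtain ⟨t, ht, htmin⟩ := exists_min_image (c.list r) (I.resRank r) ha.2.1
  have htt : t ∈ topTie I c r := mem_topTie.2 ⟨ht, htmin⟩
  by_cases hf : ((topTie I c r).filter fun h => (r, h) ∉ c.proposed).Nonempty
  · obtain ⟨h, hh, hmin⟩ := exists_min_image _ I.lower hf
    rw [mem_filter] at hh
    exact ⟨h, ha, hh.1, Or.inl ⟨hh.2, fun h' h1 h2 => hmin h' (mem_filter.2 ⟨h1, h2⟩)⟩⟩
  · obtain ⟨h, hh, hmin⟩ := exists_min_image _ I.lower ⟨t, htt⟩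
    refine ⟨h, ha, hh, Or.inr ⟨fun h' h1 => ?_, hmin⟩⟩
    by_contra hcon
    exact hf ⟨h', mem_filter.2 ⟨h1, hcon⟩⟩

lemma exists_isVictim (I : Instance n m) (c : Config n m) (r : Fin n) (h : Fin m) :
    ∃ r', IsVictim I c r h r' := by
  obtain ⟨x, hx, hmax⟩ := exists_max_image (candidates c r h) (I.hospRank h) ⟨r, by simp⟩
  obtain ⟨y, hy, hmin⟩ := exists_min_image
    ((candidates c r h).filter fun z => I.hospRank h z = I.hospRank h x) c.state
    ⟨x, mem_filter.2 ⟨hx, rfl⟩⟩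
  rw [mem_filter] at hy
  exact ⟨y, hy.1, fun z hz => hy.2 ▸ hmax z hz,
    fun z hz he => hmin z (mem_filter.2 ⟨hz, he.trans hy.2⟩)⟩

lemma exists_step (ha : Active c r) : ∃ c', Step I c c' := by
  obtain ⟨h, hp⟩ := exists_mayPropose (I := I) ha
  by_cases h1 : #(assigned c.M h) < I.lower h
  · exact ⟨_, .acceptLower c r h hp h1⟩
  rw [not_lt] at h1
  by_cases h2 : ∃ r' ∈ candidates c r h, (r', h) ∉ c.rejected
  · obtain ⟨r', h3, h4⟩ := h2
    exact ⟨_, .rejectFirst c r h r' hp h1 h3 h4⟩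
  push Not at h2
  by_cases h3 : #(assigned c.M h) < I.upper h
  · exact ⟨_, .acceptUpper c r h hp h1 h2 h3⟩
  rw [not_lt] at h3
  obtain ⟨r', hr'⟩ := exists_isVictim I c r h
  exact ⟨_, .rejectWorst c r h r' hp h1 h2 h3 hr'⟩

lemma not_exists_infinite (I : Instance n m) :
    ¬ ∃ f : ℕ → Config n m, f 0 = initConfig I ∧ ∀ k, Step I (f k) (f (k + 1)) := by
  rintro ⟨f, h0, hf⟩
  have hi : ∀ k, Inv I (f k) := fun k => by
    induction k with
    | zero => rw [h0]; exact inv_init I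
    | succ k ih => exact ih.step (hf k)
  have hle : ∀ k, potential (f k) + k ≤ potential (f 0) := fun k => by
    induction k with
    | zero => rfl
    | succ k ih => have := (hi k).potential_lt (hf k); omega
  have := hle (potential (f 0) + 1)
  omega

lemma Inv.exists_final (hi : Inv I c) :
    ∃ c', Relation.ReflTransGen (Step I) c c' ∧ ∀ r, ¬ Active c' r := by
  induction hk : potential c using Nat.strong_induction_on generalizing c with
  | _ k ih =>
    by_cases ha : ∃ r, Active c r
    · obtain ⟨r, ha⟩ := ha
      obtain ⟨c', hs⟩ := exists_step (I := I) ha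
      obtain ⟨c'', h1, h2⟩ := ih _ (hk ▸ hi.potential_lt hs) (hi.step hs) rfl
      exact ⟨c'', .head hs h1, h2⟩
    · exact ⟨c, .refl, not_exists.1 ha⟩

lemma IsOutput.exists_inv (ho : IsOutput I M) :
    ∃ c, Inv I c ∧ (∀ r, ¬ Active c r) ∧ c.M = M := by
  obtain ⟨c, hc, hc'⟩ := ho
  refine ⟨c, ?_, hc'⟩
  clear hc'
  induction hc with
  | refl => exact inv_init I
  | tail _ hs ih => exact ih.step hs

/-- A resident who still has `h` in her first list ends up in a hospital that is at least as good. -/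
lemma Inv.exists_mem (hi : Inv I c) (hna : ∀ r, ¬ Active c r) (hl : h ∈ c.list r)
    (hs : c.state r ≤ 1) : ∃ h', (r, h') ∈ c.M ∧ I.resRank r h' ≤ I.resRank r h := by
  have h1 : hospitalsOf c.M r ≠ ∅ := fun h1 => hna r ⟨h1, ⟨h, hl⟩, hs⟩
  obtain ⟨h', hh'⟩ := nonempty_iff_ne_empty.2 h1
  rw [mem_hospitalsOf] at hh'
  exact ⟨h', hh', (hi.matched r h' hh').2.1 h hl⟩

/-- If `h` was ever deleted from the list of `r`, it is full with residents no worse than `r`;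
otherwise `r` ends at a hospital no worse than `h`. -/
lemma Inv.isStable (hi : Inv I c) (hna : ∀ r, ¬ Active c r) : IsStable I c.M := by
  refine ⟨⟨?_, ?_, hi.upper⟩, ?_⟩
  · rintro ⟨r, h⟩ hM
    exact hi.mem_list r h (hi.matched r h hM).1
  · intro r
    refine card_le_one.2 fun h h1 h' h2 =>
      hi.unique r h h' (by simpa using h1) (by simpa using h2)
  · rintro r h ⟨hE, hpref, hb⟩
    by_cases hd : 0 < c.state r ∨ 0 = c.state r ∧ h ∉ c.list r
    · obtain ⟨h1, h2⟩ := hi.deleted r h 0 hE hd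
      rcases hb with hb | ⟨x, hx, hlt⟩
      · omega
      · have := (h2 x (by simpa using hx)).2
        omega
    · obtain ⟨h', hM, hle⟩ := hi.exists_mem hna (r := r) (h := h) (by grind) (by omega)
      have := hpref h' (by simpa using hM)
      omega

lemma isCorrectOn (I : Instance n m) : IsCorrectOn I := by
  refine ⟨not_exists_infinite I, ?_, ?_⟩
  · obtain ⟨c, hc, hna⟩ := (inv_init I).exists_final
    exact ⟨c.M, c, hc, hna, rfl⟩
  · intro M ho
    obtain ⟨c, hi, hna, rfl⟩ := ho.exists_inv
    exact hi.isStable hna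

/-- In an output, a resident acceptable to a hospital below its lower quota is assigned to a
preferred hospital or to one in the same tie that exceeds neither the lower quota of the former
nor its own. -/
lemma Inv.exists_mem_of_deficient (hi : Inv I c) (hna : ∀ r, ¬ Active c r) (hE : (r, h) ∈ I.E)
    (hd : #(assigned c.M h) < I.lower h) : c.state r = 0 ∧ ∃ h', (r, h') ∈ c.M ∧
      ((I.lower h' ≤ I.lower h ∧ #(assigned c.M h') ≤ I.lower h' ∧
          (h' ≠ h → (r, h') ∉ c.rejected)) ∨
        I.resRank r h' < I.resRank r h) := by
  have hnd : ¬ (0 < c.state r ∨ 0 = c.state r ∧ h ∉ c.list r) := fun hcon => by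
    have := (hi.deleted r h 0 hE hcon).1
    have := I.lower_le_upper h
    omega
  refine ⟨by omega, ?_⟩
  have hl : h ∈ c.list r := by grind
  obtain ⟨h', hM, hle⟩ := hi.exists_mem hna hl (by omega)
  refine ⟨h', hM, ?_⟩
  rcases hle.lt_or_eq with hlt | heq
  · exact Or.inr hlt
  by_cases hne : h' = h
  · subst hne; exact Or.inl ⟨le_rfl, hd.le, fun h1 => absurd rfl h1⟩
  -- A proposal to `h` that did not lead to the present assignment was rejected, and a hospital that
  -- rejects never falls below its lower quota again.
  have hnp : (r, h) ∉ c.proposed := by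
    rw [hi.proposed]
    rintro (h1 | h1)
    · have := hi.lower_le r h h1; omega
    · exact hne (hi.unique r h' h hM h1)
  obtain ⟨h1, h2⟩ := hi.not_proposed r h' h hM hl heq.symm hnp
  refine Or.inl ⟨h1, ?_, fun _ => h2⟩
  by_contra h3
  exact h2 (hi.rejected_of_lt r h' (by omega) hM)

end Algorithm

/-! ### From the invariants to the approximation bound -/

section UpperBound

open Finset

variable {n m : ℕ} {I : Instance n m} {c : Config n m} {M N : Finset (Fin n × Fin m)}
  {r : Fin n} {h : Fin m}

open Classical in
/-- The hospital of a resident in a matching, if there is one. -/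
noncomputable def hostOf (M : Finset (Fin n × Fin m)) (r : Fin n) : Option (Fin m) :=
  if h : ∃ h, (r, h) ∈ M then some h.choose else none

lemma hostOf_eq_some (hM : ∀ r, #(hospitalsOf M r) ≤ 1) : hostOf M r = some h ↔ (r, h) ∈ M := by
  unfold hostOf
  split_ifs with hr
  · have h1 := hr.choose_spec
    rw [Option.some_inj]
    refine ⟨fun he => he ▸ h1, fun h2 => card_le_one.1 (hM r) _ ?_ _ ?_⟩
    · simpa using h1
    · simpa using h2
  · simpa using fun h2 => hr ⟨h, h2⟩

lemma fiber_hostOf (hM : ∀ r, #(hospitalsOf M r) ≤ 1) (h : Fin m) :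
    fiber (hostOf M) h = assigned M h := by
  ext r; rw [mem_fiber, hostOf_eq_some hM, mem_assigned]

lemma total_hostOf (I : Instance n m) (hM : ∀ r, #(hospitalsOf M r) ≤ 1) :
    total I.lower (hostOf M) = score I M := by
  simp only [total, score, fiber_hostOf hM, satRatio, hospScore]

lemma Inv.isComparable (hi : Inv I c) (hna : ∀ r, ¬ Active c r) (hN : IsStable I N) :
    IsComparable I.lower (hostOf c.M) (hostOf N) := by
  obtain ⟨⟨hNE, hN1, hNu⟩, hNb⟩ := hN
  obtain ⟨⟨hME, hM1, -⟩, -⟩ := hi.isStable hna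
  have hnb : ∀ r h h', (r, h) ∈ N → (r, h') ∈ I.E → I.resRank r h' < I.resRank r h →
      I.upper h' ≤ #(assigned N h') ∧ ∀ x, (x, h') ∈ N → I.hospRank h' x ≤ I.hospRank h' r := by
    intro r h h' h1 h2 h3
    have h4 : ¬ (#(assigned N h') < I.upper h' ∨
        ∃ x ∈ assigned N h', I.hospRank h' r < I.hospRank h' x) := fun hcon => by
      refine hNb r h' ⟨h2, fun h'' h5 => ?_, hcon⟩
      rwa [card_le_one.1 (hN1 r) h'' h5 h (by simpa using h1)]
    push Not at h4
    exact ⟨h4.1, fun x hx => h4.2 x (by simpa using hx)⟩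
  constructor
  · intro h
    simpa using (I.lower_le_upper h).trans (I.upper_le h)
  · intro r h h1 hd
    rw [hostOf_eq_some hN1] at h1
    rw [fiber_hostOf hM1] at hd
    obtain ⟨-, h', hM, hT | hlt⟩ := hi.exists_mem_of_deficient hna (hNE h1) hd
    all_goals refine ⟨h', (hostOf_eq_some hM1).2 hM, ?_⟩
    all_goals rw [fiber_hostOf hM1, fiber_hostOf hN1]
    · exact Or.inl ⟨hT.1, hT.2.1⟩
    · have h2 := (hnb r h h' h1 (hME hM) hlt).1
      exact Or.inr ⟨(hi.upper h').trans h2, (I.lower_le_upper h').trans h2⟩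
  · intro r h h' b h1 hd hM hne hb hnone
    rw [hostOf_eq_some hN1] at h1 hb
    rw [hostOf_eq_some hM1] at hM
    rw [fiber_hostOf hM1] at hd
    have hbM : ∀ g, (b, g) ∉ c.M := fun g hg => by
      rw [(hostOf_eq_some hM1).2 hg] at hnone; cases hnone
    -- An unmatched `b` who has an acceptable hospital stops only after two exhausted lists, so `h'`
    -- deleted her in round 1.
    have hstate : 1 < c.state b := by
      by_contra hcon
      refine hna b ⟨?_, hi.list_nonempty b h' (hNE hb), by omega⟩
      rw [eq_empty_iff_forall_notMem]
      simpa using hbM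
    obtain ⟨hr0, g, hg, hor⟩ := hi.exists_mem_of_deficient hna (hNE h1) hd
    obtain rfl := hi.unique r g h' hg hM
    -- Hence `r` was rejected by `g`, and as her state is 0 she cannot merely be tied with `b`: `g`
    -- strictly prefers her. The tie case contradicts the former; in the case of strict preference,
    -- `(r, g)` would block `N`.
    obtain ⟨hrej, hrank⟩ := (hi.deleted b g 1 (hNE hb) (Or.inl hstate)).2 r hM
    rcases hor with hT | hlt
    · exact hT.2.2 hne hrej
    · have := (hnb r h g h1 (hME hM) hlt).2 b hb
      omega

/-- Every stable matching scores at most `phi n` times as much as any output. -/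
lemma IsOutput.score_le (ho : IsOutput I M) (hN : IsStable I N) (hn : 1 ≤ n) :
    score I N ≤ phi n * score I M := by
  obtain ⟨c, hi, hna, rfl⟩ := ho.exists_inv
  have h1 := (hi.isComparable hna hN).total_le_phi (by simpa using hn)
  rwa [total_hostOf I hN.1.2.1, total_hostOf I (hi.isStable hna).1.2.1, Fintype.card_fin] at h1

lemma hospScore_nonneg (I : Instance n m) (M : Finset (Fin n × Fin m)) (h : Fin m) :
    0 ≤ hospScore I M h := by
  unfold hospScore; split_ifs <;> positivity

lemma score_nonneg (I : Instance n m) (M : Finset (Fin n × Fin m)) : 0 ≤ score I M :=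
  sum_nonneg fun h _ => hospScore_nonneg I M h

/-- The approximation factor is `phi n` as soon as an instance of the model attains it. -/
lemma hasApproxFactor_phi {K : Model n} (hn : 1 ≤ n)
    (hK : ∃ (m : ℕ) (I : Instance n m) (M N : Finset (Fin n × Fin m)), K m I ∧ IsOutput I M ∧
      IsStable I N ∧ 0 < score I M ∧ score I N = phi n * score I M) :
    HasApproxFactor K (phi n) := by
  refine ⟨fun m I _ => isCorrectOn I, ⟨?_, ?_⟩, ?_⟩
  · obtain ⟨m, I, M, N, h1, h2, h3, h4, h5⟩ := hK
    exact ⟨m, I, M, N, h1, h2, ⟨h3, fun N' hN' => h5 ▸ h2.score_le hN' hn⟩, h4,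
      by rw [h5, mul_div_cancel_right₀ _ h4.ne']⟩
  · rintro ρ ⟨m, I, M, N, -, h2, h3, h4, rfl⟩
    rw [div_le_iff₀ h4]
    exact h2.score_le h3.1 hn
  · intro m I M N _ h2 h3 h4
    have := h2.score_le h3.1 hn
    rw [h4, mul_zero] at this
    exact le_antisymm this (score_nonneg I N)

end UpperBound

/-! ### The tight instance -/

section LowerBound

open Finset

variable {n : ℕ}

/-- The tight instance. The hospital `0` can take half of the residents, the hospital `1` takes any
number and has lower quota `L`, and each of the other hospitals takes one resident. Each resident
of the first half prefers the hospital `0` to her own small hospital, and each one of the second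
half is indifferent between the hospitals `0` and `1`. -/
def tight (n L : ℕ) (hL : L ≤ n) : Instance n (n / 2 + 2) where
  -- For odd `n` the last resident has no acceptable hospital. The index range of the hospitals
  -- gives private ones to the first half only.
  E := univ.filter fun p => p.1.val < 2 * (n / 2) ∧ (p.2.val = 0 ∨
    p.2.val = 1 ∧ n / 2 ≤ p.1.val ∨ p.2.val = p.1.val + 2)
  resRank _ h := if h.val ≤ 1 then 0 else 1
  hospRank _ _ := 0
  lower h := if h.val = 0 then 0 else if h.val = 1 then L else 1
  upper h := if h.val = 0 then n / 2 else if h.val = 1 then n else 1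
  lower_le_upper h := by split_ifs <;> omega
  upper_le h := by have := h.isLt; split_ifs <;> omega

variable {L : ℕ} {hL : L ≤ n}

lemma mem_tight_E {r : Fin n} {h : Fin (n / 2 + 2)} : (r, h) ∈ (tight n L hL).E ↔
    r.val < 2 * (n / 2) ∧ (h.val = 0 ∨ h.val = 1 ∧ n / 2 ≤ r.val ∨ h.val = r.val + 2) := by
  simp [tight]

lemma card_filter_Ico {a b : ℕ} (hb : b ≤ n) :
    #(univ.filter fun i : Fin n => a ≤ i.val ∧ i.val < b) = b - a := by
  rw [← card_map Fin.valEmbedding, ← Nat.card_Ico]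
  congr 1
  ext x
  simp only [mem_map, mem_filter, mem_univ, true_and, Fin.valEmbedding_apply, mem_Ico]
  exact ⟨by rintro ⟨i, hi, rfl⟩; exact hi, fun hx => ⟨⟨x, by omega⟩, hx, rfl⟩⟩

/-- The assignment of the tight execution after the first `j` residents have settled. -/
def tightMatching (n j : ℕ) : Finset (Fin n × Fin (n / 2 + 2)) :=
  univ.filter fun p => p.1.val < j ∧
    (p.2.val = 0 ∧ p.1.val < n / 2 ∨ p.2.val = 1 ∧ n / 2 ≤ p.1.val)

/-- The configuration of the tight execution after the first `j` residents have settled. -/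
def tightConfig (n L : ℕ) (hL : L ≤ n) (j : ℕ) : Config n (n / 2 + 2) where
  M := tightMatching n j
  proposed := univ.filter fun p => p.1.val < j ∧ (p.2.val = 0 ∨ p.2.val = 1 ∧ n / 2 ≤ p.1.val)
  rejected := univ.filter fun p => p.1.val < j ∧
    (p.2.val = 0 ∨ p.2.val = 1 ∧ n / 2 ≤ p.1.val ∧ L = 0)
  list := fullList (tight n L hL)
  state _ := 0

lemma tightConfig_zero : tightConfig n L hL 0 = initConfig (tight n L hL) := by
  simp [tightConfig, tightMatching, initConfig]

lemma assigned_tightMatching_zero (n j : ℕ) : assigned (tightMatching n j) 0 =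
    univ.filter fun i : Fin n => 0 ≤ i.val ∧ i.val < min j (n / 2) := by
  ext x; simp [tightMatching]

lemma assigned_tightMatching_one (n j : ℕ) : assigned (tightMatching n j) 1 =
    univ.filter fun i : Fin n => n / 2 ≤ i.val ∧ i.val < j := by
  ext x; simp [tightMatching, and_comm]

/-- A resident who proposes to a hospital for the first time can be rejected at once. -/
lemma Step.rejectSelf {m : ℕ} {I : Instance n m} {c : Config n m} {r : Fin n} {h : Fin m}
    (hp : MayPropose I c r h) (hlow : I.lower h ≤ #(assigned c.M h)) (hr : (r, h) ∉ c.rejected) :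
    Step I c { c with
      proposed := insert (r, h) c.proposed
      rejected := insert (r, h) c.rejected } := by
  have h1 := Step.rejectFirst c r h r hp hlow (by simp) hr
  rwa [erase_insert (hp.spec.1 h)] at h1

lemma active_of_tightConfig {r : Fin n} (hr : r.val < 2 * (n / 2)) {c : Config n (n / 2 + 2)}
    (hM : c.M = tightMatching n r) (hl : c.list = fullList (tight n L hL))
    (hs : c.state r = 0) : Active c r := by
  refine ⟨?_, ⟨0, ?_⟩, by omega⟩
  · rw [eq_empty_iff_forall_notMem]
    intro h
    rw [mem_hospitalsOf, hM]
    simp [tightMatching]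
  · rw [hl]; simp [mem_tight_E, hr]

lemma eq_zero_iff_val {k : ℕ} (y : Fin (k + 2)) : y = 0 ↔ y.val = 0 := Fin.ext_iff

lemma eq_one_iff_val {k : ℕ} (y : Fin (k + 2)) : y = 1 ↔ y.val = 1 := by
  rw [Fin.ext_iff, Fin.val_one]

lemma tight_resRank (r : Fin n) (h : Fin (n / 2 + 2)) :
    (tight n L hL).resRank r h = if h.val ≤ 1 then 0 else 1 := rfl

lemma mem_topTie_tight {r : Fin n} (hr : r.val < 2 * (n / 2)) {c : Config n (n / 2 + 2)}
    (hl : c.list = fullList (tight n L hL)) {h : Fin (n / 2 + 2)} :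
    h ∈ topTie (tight n L hL) c r ↔ h.val = 0 ∨ h.val = 1 ∧ n / 2 ≤ r.val := by
  rw [mem_topTie, hl, mem_fullList, mem_tight_E]
  simp only [mem_fullList, tight_resRank]
  constructor
  · rintro ⟨h1, h2⟩
    have h3 := h2 0 (by simp [mem_tight_E, hr])
    rw [Fin.val_zero, if_pos (Nat.zero_le 1)] at h3
    split_ifs at h3 <;> omega
  · intro h1
    refine ⟨by omega, fun h' _ => ?_⟩
    rw [if_pos (by omega)]
    exact Nat.zero_le _

lemma mem_tightMatching {j : ℕ} {x : Fin n} {y : Fin (n / 2 + 2)} : (x, y) ∈ tightMatching n j ↔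
    x.val < j ∧ (y.val = 0 ∧ x.val < n / 2 ∨ y.val = 1 ∧ n / 2 ≤ x.val) := by
  rw [tightMatching, mem_filter_univ]

lemma mem_tightConfig_proposed {j : ℕ} {x : Fin n} {y : Fin (n / 2 + 2)} :
    (x, y) ∈ (tightConfig n L hL j).proposed ↔
      x.val < j ∧ (y.val = 0 ∨ y.val = 1 ∧ n / 2 ≤ x.val) := by
  rw [tightConfig, mem_filter_univ]

lemma mem_tightConfig_rejected {j : ℕ} {x : Fin n} {y : Fin (n / 2 + 2)} :
    (x, y) ∈ (tightConfig n L hL j).rejected ↔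
      x.val < j ∧ (y.val = 0 ∨ y.val = 1 ∧ n / 2 ≤ x.val ∧ L = 0) := by
  rw [tightConfig, mem_filter_univ]

lemma Config.ext_mem {m : ℕ} {c d : Config n m} (hM : ∀ x y, (x, y) ∈ c.M ↔ (x, y) ∈ d.M)
    (hP : ∀ x y, (x, y) ∈ c.proposed ↔ (x, y) ∈ d.proposed)
    (hR : ∀ x y, (x, y) ∈ c.rejected ↔ (x, y) ∈ d.rejected)
    (hl : c.list = d.list) (hs : c.state = d.state) : c = d := by
  cases c; cases d
  rw [Config.mk.injEq]
  exact ⟨Finset.ext fun p => hM p.1 p.2, Finset.ext fun p => hP p.1 p.2,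
    Finset.ext fun p => hR p.1 p.2, hl, hs⟩

lemma tight_lower_of_zero {h : Fin (n / 2 + 2)} (hh : h.val = 0) :
    (tight n L hL).lower h = 0 := if_pos hh

lemma tight_lower_of_one {h : Fin (n / 2 + 2)} (hh : h.val = 1) :
    (tight n L hL).lower h = L := by
  unfold tight; dsimp only; rw [if_neg (by omega), if_pos hh]

/-- Resident `j` first proposes to hospital `0`, whose lower quota 0 lets it reject her at once. In
the first half she repeats the proposal and is kept. In the second half the untried hospital `1`
takes precedence; it accepts immediately if `L = n`, and after one rejection and a repeated proposal
if `L = 0`. -/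
lemma tight_run {j : ℕ} (hj : j < 2 * (n / 2)) (hL' : L = n ∨ L = 0) :
    Relation.ReflTransGen (Step (tight n L hL)) (tightConfig n L hL j)
      (tightConfig n L hL (j + 1)) := by
  have hjn : j < n := by omega
  obtain ⟨r, hrv⟩ : ∃ r : Fin n, r.val = j := ⟨⟨j, hjn⟩, rfl⟩
  have hr : r.val < 2 * (n / 2) := hrv ▸ hj
  have hxr : ∀ x : Fin n, x = r ↔ x.val = j := fun x => by rw [Fin.ext_iff, hrv]
  have v0 : (0 : Fin (n / 2 + 2)).val = 0 := rfl
  have v1 : (1 : Fin (n / 2 + 2)).val = 1 := Fin.val_one _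
  have low0 : (tight n L hL).lower 0 = 0 := tight_lower_of_zero v0
  have low1 : (tight n L hL).lower 1 = L := tight_lower_of_one v1
  have upp0 : (tight n L hL).upper 0 = n / 2 := rfl
  have upp1 : (tight n L hL).upper 1 = n := by
    unfold tight; dsimp only; rw [v1, if_neg one_ne_zero, if_pos rfl]
  have c0 : #(assigned (tightMatching n j) 0) = min j (n / 2) := by
    rw [assigned_tightMatching_zero, card_filter_Ico (by omega), Nat.sub_zero]
  have c1 : #(assigned (tightMatching n j) 1) = j - n / 2 := by
    rw [assigned_tightMatching_one, card_filter_Ico (by omega)]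
  have step1 := Step.rejectSelf (I := tight n L hL) (c := tightConfig n L hL j) (r := r) (h := 0)
    ⟨active_of_tightConfig (hL := hL) hr (by rw [hrv]; rfl) rfl rfl,
      (mem_topTie_tight hr rfl).2 (Or.inl v0),
      Or.inl ⟨by rw [mem_tightConfig_proposed]; omega,
        fun h' _ _ => by rw [low0]; exact Nat.zero_le _⟩⟩
    (by rw [low0]; exact Nat.zero_le _) (by rw [mem_tightConfig_rejected]; omega)
  refine .head step1 ?_
  generalize hd : ({ tightConfig n L hL j with
      proposed := insert (r, 0) (tightConfig n L hL j).proposed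
      rejected := insert (r, 0) (tightConfig n L hL j).rejected } : Config n (n / 2 + 2)) = d
  have hdM : d.M = tightMatching n j := hd ▸ rfl
  have hdl : d.list = fullList (tight n L hL) := hd ▸ rfl
  have hds : d.state = fun _ => 0 := hd ▸ rfl
  have hdP : ∀ x y, (x, y) ∈ d.proposed ↔ (x.val = j ∧ y.val = 0) ∨ x.val < j ∧
      (y.val = 0 ∨ y.val = 1 ∧ n / 2 ≤ x.val) := by
    intro x y; subst hd
    rw [mem_insert, mem_tightConfig_proposed, Prod.mk.injEq, hxr, eq_zero_iff_val]
  have hdR : ∀ x y, (x, y) ∈ d.rejected ↔ (x.val = j ∧ y.val = 0) ∨ x.val < j ∧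
      (y.val = 0 ∨ y.val = 1 ∧ n / 2 ≤ x.val ∧ L = 0) := by
    intro x y; subst hd
    rw [mem_insert, mem_tightConfig_rejected, Prod.mk.injEq, hxr, eq_zero_iff_val]
  have hact : Active d r :=
    active_of_tightConfig (hL := hL) hr (by rw [hdM, hrv]) hdl (by rw [hds])
  clear hd step1
  by_cases hjk : j < n / 2
  · have step2 := Step.acceptUpper (I := tight n L hL) d r 0
      ⟨hact, (mem_topTie_tight hr hdl).2 (Or.inl v0), Or.inr
        ⟨fun h' hh' => by rw [mem_topTie_tight hr hdl] at hh'; rw [hdP]; omega,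
          fun h' _ => by rw [low0]; exact Nat.zero_le _⟩⟩
      (by rw [low0]; exact Nat.zero_le _)
      (fun x hx => by
        rw [mem_candidates, hxr, hdM, mem_tightMatching] at hx
        rw [hdR]; omega)
      (by rw [upp0, hdM, c0]; omega)
    refine .single ?_
    convert step2 using 1
    refine Config.ext_mem (fun x y => ?_) (fun x y => ?_) (fun x y => ?_) hdl.symm hds.symm
    all_goals dsimp only
    · rw [mem_insert, hdM, Prod.mk.injEq, hxr, eq_zero_iff_val, mem_tightMatching]
      change (x, y) ∈ tightMatching n (j + 1) ↔ _
      rw [mem_tightMatching]; omega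
    · rw [mem_insert, hdP, Prod.mk.injEq, hxr, eq_zero_iff_val, mem_tightConfig_proposed]
      omega
    · rw [hdR, mem_tightConfig_rejected]; omega
  have hprop : MayPropose (tight n L hL) d r 1 := by
    refine ⟨hact, (mem_topTie_tight hr hdl).2 (Or.inr ⟨v1, by omega⟩),
      Or.inl ⟨by rw [hdP]; omega, fun h' hh' hnp => ?_⟩⟩
    rw [mem_topTie_tight hr hdl] at hh'
    rw [hdP] at hnp
    rw [low1, tight_lower_of_one (by omega)]
  rcases hL' with rfl | rfl
  · have step2 := Step.acceptLower (I := tight L L hL) d r 1 hprop (by rw [low1, hdM, c1]; omega)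
    refine .single ?_
    convert step2 using 1
    refine Config.ext_mem (fun x y => ?_) (fun x y => ?_) (fun x y => ?_) hdl.symm hds.symm
    all_goals dsimp only
    · rw [mem_insert, hdM, Prod.mk.injEq, hxr, eq_one_iff_val, mem_tightMatching]
      change (x, y) ∈ tightMatching L (j + 1) ↔ _
      rw [mem_tightMatching]; omega
    · rw [mem_insert, hdP, Prod.mk.injEq, hxr, eq_one_iff_val, mem_tightConfig_proposed]
      omega
    · rw [hdR, mem_tightConfig_rejected]; omega
  · have step2 := Step.rejectSelf hprop (by rw [low1]; exact Nat.zero_le _) (by rw [hdR]; omega)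
    refine .head step2 ?_
    have step3 := Step.acceptUpper (I := tight n 0 hL)
      { d with proposed := insert (r, 1) d.proposed, rejected := insert (r, 1) d.rejected } r 1
      ⟨hact, (mem_topTie_tight hr hdl).2 (Or.inr ⟨v1, by omega⟩), Or.inr
        ⟨fun h' hh' => by
          rw [mem_topTie_tight hr (by exact hdl)] at hh'
          dsimp only
          rw [mem_insert, Prod.mk.injEq, hxr, eq_one_iff_val, hdP]; omega,
          fun h' _ => by rw [low1]; exact Nat.zero_le _⟩⟩
      (by rw [low1]; exact Nat.zero_le _)
      (fun x hx => by
        rw [mem_candidates, hxr] at hx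
        dsimp only at hx ⊢
        rw [hdM, mem_tightMatching, v1] at hx
        rw [mem_insert, Prod.mk.injEq, hxr, eq_one_iff_val, hdR, v1]; omega)
      (by dsimp only; rw [upp1, hdM, c1]; omega)
    refine .single ?_
    convert step3 using 1
    refine Config.ext_mem (fun x y => ?_) (fun x y => ?_) (fun x y => ?_) hdl.symm hds.symm
    all_goals dsimp only
    · rw [mem_insert, hdM, Prod.mk.injEq, hxr, eq_one_iff_val, mem_tightMatching]
      change (x, y) ∈ tightMatching n (j + 1) ↔ _
      rw [mem_tightMatching]; omega
    · rw [mem_insert, mem_insert, hdP, Prod.mk.injEq, hxr, eq_one_iff_val,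
        mem_tightConfig_proposed]
      omega
    · rw [mem_insert, hdR, Prod.mk.injEq, hxr, eq_one_iff_val, mem_tightConfig_rejected]; omega

lemma tight_isOutput (hL' : L = n ∨ L = 0) :
    IsOutput (tight n L hL) (tightMatching n (2 * (n / 2))) := by
  have hrun : ∀ j ≤ 2 * (n / 2), Relation.ReflTransGen (Step (tight n L hL))
      (initConfig (tight n L hL)) (tightConfig n L hL j) := fun j => by
    induction j with
    | zero => intro; rw [tightConfig_zero]
    | succ j ih => exact fun hj => (ih (by omega)).trans (tight_run hj hL')
  refine ⟨_, hrun _ le_rfl, fun r ha => ?_, rfl⟩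
  obtain ⟨h, hh⟩ := ha.2.1
  have hr : r.val < 2 * (n / 2) := (mem_tight_E.1 (mem_fullList.1 hh)).1
  have hn0 := ha.not_mem 0
  have hn1 := ha.not_mem 1
  change _ ∉ tightMatching n _ at hn0 hn1
  rw [mem_tightMatching] at hn0 hn1
  have v0 : (0 : Fin (n / 2 + 2)).val = 0 := rfl
  have v1 : (1 : Fin (n / 2 + 2)).val = 1 := Fin.val_one _
  omega

/-- The optimal matching of the tight instance. -/
def tightOptimal (n : ℕ) : Finset (Fin n × Fin (n / 2 + 2)) :=
  univ.filter fun p => n / 2 ≤ p.1.val ∧ p.1.val < 2 * (n / 2) ∧ p.2.val = 0 ∨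
    p.1.val < n / 2 ∧ p.2.val = p.1.val + 2

lemma mem_tightOptimal {x : Fin n} {y : Fin (n / 2 + 2)} : (x, y) ∈ tightOptimal n ↔
    n / 2 ≤ x.val ∧ x.val < 2 * (n / 2) ∧ y.val = 0 ∨ x.val < n / 2 ∧ y.val = x.val + 2 := by
  rw [tightOptimal, mem_filter_univ]

lemma card_assigned_tightOptimal (h : Fin (n / 2 + 2)) : #(assigned (tightOptimal n) h) =
    if h.val = 0 then n / 2 else if h.val = 1 then 0 else 1 := by
  have hlt := h.isLt
  split_ifs with h0 h1
  · trans #(univ.filter fun i : Fin n => n / 2 ≤ i.val ∧ i.val < 2 * (n / 2))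
    · congr 1; ext x
      rw [mem_assigned, mem_tightOptimal, mem_filter_univ]; omega
    · rw [card_filter_Ico (by omega)]; omega
  · rw [card_eq_zero, eq_empty_iff_forall_notMem]
    intro x
    rw [mem_assigned, mem_tightOptimal]; omega
  · rw [card_eq_one]
    refine ⟨⟨h.val - 2, by omega⟩, ?_⟩
    ext x
    rw [mem_assigned, mem_tightOptimal, mem_singleton, Fin.ext_iff]
    dsimp only
    omega

lemma tightOptimal_isStable : IsStable (tight n L hL) (tightOptimal n) := by
  refine ⟨⟨?_, ?_, ?_⟩, ?_⟩
  · rintro ⟨x, y⟩ h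
    rw [mem_tightOptimal] at h
    rw [mem_tight_E]
    omega
  · intro r
    refine card_le_one.2 fun x hx y hy => ?_
    rw [mem_hospitalsOf, mem_tightOptimal] at hx hy
    rw [Fin.ext_iff]; omega
  · intro h
    rw [card_assigned_tightOptimal]
    unfold tight; dsimp only
    split_ifs <;> omega
  · rintro r h ⟨hE, hpref, hb⟩
    rw [mem_tight_E] at hE
    have hb' : #(assigned (tightOptimal n) h) < (tight n L hL).upper h := by
      rcases hb with hb | ⟨x, -, hx⟩
      · exact hb
      · exact absurd hx (lt_irrefl _)
    rw [card_assigned_tightOptimal] at hb'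
    simp only [mem_hospitalsOf, tight_resRank] at hpref
    unfold tight at hb'; dsimp only at hb'
    by_cases h1 : h.val = 1
    · have := hpref 0 (by rw [mem_tightOptimal]; left; simp; omega)
      rw [Fin.val_zero, if_pos (Nat.zero_le 1)] at this
      omega
    · split_ifs at hb' <;> omega

lemma score_tight (N : Finset (Fin n × Fin (n / 2 + 2))) : score (tight n L hL) N =
    1 + (satRatio L (#(assigned N 1)) +
      ∑ i : Fin (n / 2), satRatio 1 (#(assigned N i.succ.succ))) := by
  unfold score
  rw [Fin.sum_univ_succ, Fin.sum_univ_succ]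
  congr 1

lemma tight_attains (hn : 1 ≤ n) : ∃ (m : ℕ) (I : Instance n m) (M N : Finset (Fin n × Fin m)),
    masterListModel n m I ∧ IsOutput I M ∧ IsStable I N ∧ 0 < score I M ∧
      score I N = phi n * score I M := by
  -- With `k = ⌊n/2⌋`, `L = n` gives the ratio `(1 + k) / (1 + k/n)`. For `n = 2` this is only
  -- `4/3`, and `L = 0` gives `3/2`, since hospital `1` then contributes one to both scores.
  obtain ⟨L, hLn, hL', hphi⟩ : ∃ L ≤ n, (L = n ∨ L = 0) ∧
      1 + (satRatio L 0 + (n / 2 : ℕ)) = phi n * (1 + satRatio L (n / 2)) := by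
    by_cases h2 : n = 2
    · subst h2
      refine ⟨0, by omega, Or.inr rfl, ?_⟩
      simp [satRatio, phi]; norm_num
    · refine ⟨n, le_rfl, Or.inl rfl, ?_⟩
      have hpos : (0 : ℝ) < n := by exact_mod_cast hn
      rw [satRatio_of_lt (by omega), satRatio_of_lt (by omega)]
      unfold phi
      split_ifs with h1
      · subst h1; norm_num
      · field_simp
        ring
  refine ⟨_, tight n L hLn, _, tightOptimal n, ⟨fun h => if h.val ≤ 1 then 0 else 1,
    fun _ _ _ _ _ => Iff.rfl⟩, tight_isOutput hL', tightOptimal_isStable, ?_, ?_⟩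
  · rw [score_tight]
    have := satRatio_nonneg L (#(assigned (tightMatching n (2 * (n / 2))) 1))
    have := sum_nonneg fun (i : Fin (n / 2)) (_ : i ∈ univ) =>
      satRatio_nonneg 1 (#(assigned (tightMatching n (2 * (n / 2))) i.succ.succ))
    linarith
  · rw [score_tight, score_tight, assigned_tightMatching_one, card_filter_Ico (by omega),
      card_assigned_tightOptimal, Fin.val_one, if_neg one_ne_zero, if_pos rfl]
    have e1 : ∀ i : Fin (n / 2), satRatio 1 (#(assigned (tightOptimal n) i.succ.succ)) = 1 := by
      intro i
      refine satRatio_of_le ?_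
      rw [card_assigned_tightOptimal, Fin.val_succ, Fin.val_succ, if_neg (by omega),
        if_neg (by omega)]
    have e2 : ∀ i : Fin (n / 2),
        satRatio 1 (#(assigned (tightMatching n (2 * (n / 2))) i.succ.succ)) = 0 := by
      intro i
      have : assigned (tightMatching n (2 * (n / 2))) i.succ.succ = ∅ := by
        rw [eq_empty_iff_forall_notMem]
        intro x
        rw [mem_assigned, mem_tightMatching, Fin.val_succ, Fin.val_succ]
        omega
      rw [this]
      simp [satRatio]
    simp only [e1, e2]
    have e3 : 2 * (n / 2) - n / 2 = n / 2 := by omega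
    rw [e3]
    simpa using hphi

end LowerBound
end HRTMSLQ

theorem mainTheorem1 (n : ℕ) (hn : 1 ≤ n) :
    HRTMSLQ.HasApproxFactor (HRTMSLQ.generalModel n) (HRTMSLQ.phi n) ∧
    HRTMSLQ.HasApproxFactor (HRTMSLQ.masterListModel n) (HRTMSLQ.phi n) := by
  have h := HRTMSLQ.tight_attains hn
  refine ⟨HRTMSLQ.hasApproxFactor_phi hn ?_, HRTMSLQ.hasApproxFactor_phi hn h⟩
  obtain ⟨m, I, M, N, -, h⟩ := h
  exact ⟨m, I, M, N, trivial, h⟩
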